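/- Let $N\ge 2$, let $\Omega_0\subset\mathbb{R}^N$ be a bounded strictly convex domain (non-empty, open and convex, with strictly convex closure), let $\sigma$ be the surface measure on the unit sphere $S^{N-1}$, and let $\varepsilon>0$, $K>0$ and $0<\delta_\varepsilon<\frac12\sigma(S^{N-1})$. Call a measurable set $A\subset S^{N-1}$ admissible if $\sigma(A)\ge\frac12\sigma(S^{N-1})+\delta_\varepsilon$. Consider the following two-person zero-sum game, started at $x_0\in\mathbb{R}^N$. At round $i\ge1$, Paul chooses an admissible set $A_i$ and Carol chooses an admissible set $B_i$, and the next position is $x_i=x_{i-1}+\varepsilon v_i$, where $v_i$ is drawn uniformly (with respect to $\sigma$) from $A_i\cap B_i$, which has positive measure. A strategy ($S_p$ for Paul, $S_c$ for Carol) prescribes, in a measurable way, the player's admissible set at each round as a function of the positions $x_0,\dots,x_{i-1}$ visited so far. The game ends when the position leaves $\Omega_0$; let $\tau=\inf\{n\ge0: x_n\notin\Omega_0\}\in\{0,1,2,\dots\}\cup\{\infty\}$ be the number of plays. Carol pays Paul $\varepsilon^2K\tau$. Paul maximizes and Carol minimizes the expected payoff $\mathbb{E}^{x_0}_{S_p,S_c}[\varepsilon^2K\tau]\in[0,\infty]$.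 Then the game has a value: for every $x_0\in\mathbb{R}^N$, $$ u^\varepsilon(x_0):=\inf_{S_c}\sup_{S_p}\mathbb{E}^{x_0}_{S_p,S_c}[\varepsilon^2K\tau]=\sup_{S_p}\inf_{S_c}\mathbb{E}^{x_0}_{S_p,S_c}[\varepsilon^2K\tau]<\infty . $$ Moreover, $u^\varepsilon$ is the unique solution of the dynamic programming principle $$ \begin{cases} \displaystyle u(x)=\sup_{A}\inf_{B}\left\{\frac1{\sigma(A\cap B)}\int_{A\cap B}u(x+\varepsilon v)\,d\sigma(v)\right\}+\varepsilon^2K, & x\in\Omega_0,\\[8pt] u(x)=0, & x\in\mathbb{R}^N\setminus\Omega_0, \end{cases} $$ where $A$ and $B$ range over the admissible sets, and where a solution is a Borel function $u:\mathbb{R}^N\to\mathbb{R}$ such that $v\mapsto u(x+\varepsilon v)$ is $\sigma$-integrable on $S^{N-1}$ for every $x\in\Omega_0$ and both equations hold. -/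

import Mathlib

open MeasureTheory ProbabilityTheory
open scoped ENNReal

noncomputable section

namespace SphereGame

/-- The space `ℝ^N` with its Euclidean norm. -/
abbrev E (N : ℕ) : Type := EuclideanSpace ℝ (Fin N)

/-- The unit sphere `S^{N-1}`. -/
abbrev S (N : ℕ) : Type := Metric.sphere (0 : E N) 1

/-- The surface measure on `S^{N-1}`. -/
def σ (N : ℕ) : Measure (S N) := (volume : Measure (E N)).toSphere

instance (N : ℕ) : IsFiniteMeasure (σ N) := by unfold σ; infer_instance

/-- The sets that a player may choose: measurable subsets of the sphere whose surface measure is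
at least half of that of the sphere plus `δ`. -/
def admissible (N : ℕ) (δ : ℝ) : Set (Set (S N)) :=
  {A | MeasurableSet A ∧ (1 / 2) * (σ N).real Set.univ + δ ≤ (σ N).real A}

/-- A strategy: after `n` rounds it assigns to the history `(x_0, …, x_n)` of positions an
admissible set of directions, in a jointly measurable way. -/
structure Strategy (N : ℕ) (δ : ℝ) where
  choice : (n : ℕ) → (Finset.Iic n → E N) → Set (S N)
  choice_mem : ∀ n h, choice n h ∈ admissible N δ
  measurable_choice : ∀ n, MeasurableSet {p : (Finset.Iic n → E N) × S N | p.2 ∈ choice n p.1}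

/-- Two admissible sets meet in a set of positive surface measure. -/
theorem measure_inter_ne_zero {N : ℕ} {δ : ℝ} (hδ : 0 < δ) {A B : Set (S N)}
    (hA : A ∈ admissible N δ) (hB : B ∈ admissible N δ) : σ N (A ∩ B) ≠ 0 := by
  intro h
  have h0 : (σ N).real (A ∩ B) = 0 := by simp [Measure.real, h]
  have h1 := measureReal_union_add_inter (μ := σ N) (s := A) (t := B) hB.1
  have h2 : (σ N).real (A ∪ B) ≤ (σ N).real Set.univ := measureReal_mono (Set.subset_univ _)
  have h3 := hA.2
  have h4 := hB.2
  linarith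

/-- The law of the next position `x_{n+1} = x_n + ε v` given the history `(x_0, …, x_n)`, where `v`
is uniformly distributed on the intersection of the sets chosen by the two players. -/
def stepLaw {N : ℕ} {δ : ℝ} (ε : ℝ) (P C : Strategy N δ) (n : ℕ) (h : Finset.Iic n → E N) :
    Measure (E N) :=
  (cond (σ N) (P.choice n h ∩ C.choice n h)).map
    fun v : S N => h ⟨n, Finset.mem_Iic.2 le_rfl⟩ + ε • (v : E N)

theorem measurable_stepLaw {N : ℕ} {δ : ℝ} (ε : ℝ) (P C : Strategy N δ) (n : ℕ) :
    Measurable (stepLaw ε P C n) := by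
  have hPC : MeasurableSet {p : (Finset.Iic n → E N) × S N |
      p.2 ∈ P.choice n p.1 ∩ C.choice n p.1} :=
    (P.measurable_choice n).inter (C.measurable_choice n)
  have hf : Measurable fun p : (Finset.Iic n → E N) × S N =>
      p.1 ⟨n, Finset.mem_Iic.2 le_rfl⟩ + ε • (p.2 : E N) := by fun_prop
  refine Measure.measurable_of_measurable_coe _ fun s hs => ?_
  have key : ∀ h : Finset.Iic n → E N, stepLaw ε P C n h s =
      (σ N (Prod.mk h ⁻¹' {p | p.2 ∈ P.choice n p.1 ∩ C.choice n p.1}))⁻¹ *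
        σ N (Prod.mk h ⁻¹' ({p | p.2 ∈ P.choice n p.1 ∩ C.choice n p.1} ∩
          (fun p : (Finset.Iic n → E N) × S N =>
            p.1 ⟨n, Finset.mem_Iic.2 le_rfl⟩ + ε • (p.2 : E N)) ⁻¹' s)) := by
    intro h
    have hv : Measurable fun v : S N => h ⟨n, Finset.mem_Iic.2 le_rfl⟩ + ε • (v : E N) := by
      fun_prop
    rw [stepLaw, Measure.map_apply hv hs,
      cond_apply ((P.choice_mem n h).1.inter (C.choice_mem n h).1)]
    rfl
  simp_rw [key]
  exact (measurable_measure_prodMk_left hPC).inv.mul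
    (measurable_measure_prodMk_left (hPC.inter (hf hs)))

/-- `stepLaw` as a transition kernel. -/
def stepKernel {N : ℕ} {δ : ℝ} (ε : ℝ) (P C : Strategy N δ) (n : ℕ) :
    Kernel (Finset.Iic n → E N) (E N) where
  toFun := stepLaw ε P C n
  measurable' := measurable_stepLaw ε P C n

theorem isMarkovKernel_stepKernel {N : ℕ} {δ : ℝ} (hδ : 0 < δ) (ε : ℝ) (P C : Strategy N δ)
    (n : ℕ) : IsMarkovKernel (stepKernel ε P C n) := by
  refine ⟨fun h => ?_⟩
  have h1 : IsProbabilityMeasure (cond (σ N) (P.choice n h ∩ C.choice n h)) :=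
    cond_isProbabilityMeasure (measure_inter_ne_zero hδ (P.choice_mem n h) (C.choice_mem n h))
  have hv : Measurable fun v : S N => h ⟨n, Finset.mem_Iic.2 le_rfl⟩ + ε • (v : E N) := by
    fun_prop
  exact Measure.isProbabilityMeasure_map hv.aemeasurable

/-- The law of the sequence of positions `(x_0, x_1, x_2, …)` of the game started at `x` when Paul
uses `P` and Carol uses `C`. The sequence is continued after the exit from the domain, which
does not affect the number of plays. -/
def gameLaw {N : ℕ} {δ : ℝ} (hδ : 0 < δ) (ε : ℝ) (P C : Strategy N δ) (x : E N) :
    Measure (ℕ → E N) :=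
  haveI : ∀ n, IsMarkovKernel (stepKernel ε P C n) := isMarkovKernel_stepKernel hδ ε P C
  Kernel.traj (X := fun _ => E N) (stepKernel ε P C) 0 fun _ => x

/-- The number of plays: the first `n` with `x_n ∉ Ω`, and `∞` if there is none. -/
def numPlays {N : ℕ} (Ω : Set (E N)) (ω : ℕ → E N) : ℝ≥0∞ :=
  ⨅ (n : ℕ) (_ : ω n ∉ Ω), (n : ℝ≥0∞)

/-- The expected payoff `𝔼[ε² K × (number of plays)]`, possibly infinite. -/
def payoff {N : ℕ} {δ : ℝ} (hδ : 0 < δ) (ε K : ℝ) (Ω : Set (E N)) (P C : Strategy N δ)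
    (x : E N) : ℝ≥0∞ :=
  ∫⁻ ω, ENNReal.ofReal (ε ^ 2 * K) * numPlays Ω ω ∂(gameLaw hδ ε P C x)

/-- `inf` over Carol's strategies of the `sup` over Paul's strategies of the expected payoff. -/
def upperValue {N : ℕ} {δ : ℝ} (hδ : 0 < δ) (ε K : ℝ) (Ω : Set (E N)) (x : E N) : ℝ≥0∞ :=
  ⨅ C : Strategy N δ, ⨆ P : Strategy N δ, payoff hδ ε K Ω P C x

/-- `sup` over Paul's strategies of the `inf` over Carol's strategies of the expected payoff. -/
def lowerValue {N : ℕ} {δ : ℝ} (hδ : 0 < δ) (ε K : ℝ) (Ω : Set (E N)) (x : E N) : ℝ≥0∞ :=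
  ⨆ P : Strategy N δ, ⨅ C : Strategy N δ, payoff hδ ε K Ω P C x

/-- Solutions of the dynamic programming principle. The first two conditions say that the averages
in the equation make sense. -/
structure IsDPPSolution {N : ℕ} (ε δ K : ℝ) (Ω : Set (E N)) (u : E N → ℝ) : Prop where
  measurable : Measurable u
  integrable : ∀ x ∈ Ω, Integrable (fun v : S N => u (x + ε • (v : E N))) (σ N)
  eq_of_mem : ∀ x ∈ Ω, u x =
    (⨆ A : admissible N δ, ⨅ B : admissible N δ,
      ⨍ v in (A : Set (S N)) ∩ (B : Set (S N)), u (x + ε • (v : E N)) ∂(σ N)) + ε ^ 2 * K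
  eq_zero : ∀ x, x ∉ Ω → u x = 0

end SphereGame

end

/-! ### The surface measure and its convolution square -/

noncomputable section

namespace SphereGame

open scoped Pointwise

/-! One round with a fixed payoff `f` on the sphere has a saddle point. Order the directions by the
value of `f`, breaking ties measurably. As `σ` has no atoms, Paul can take a top portion and Carol a
bottom portion of exactly the smallest admissible measure. Any two admissible sets overlap in
measure at least `2δ`, and these two overlap in exactly `2δ`; comparing averages shows that neither
player gains by deviating (`iSup_iInf_average`). The portions depend measurably on the position, so
playing them in every round is a strategy.

Let `w` be a bounded solution. Up to the exit, `w(x_k) + ε²Kk` is a supermartingale when Carol plays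
bottom portions and a submartingale when Paul plays top portions. Since `w` vanishes outside `Ω`,
Carol can hold the expected payoff to `w(x_0)` and Paul can secure it (`IsDPPSolution.value_eq`).
This identifies both values with `w`, so it gives uniqueness as well.

Boundedness is not part of the definition of a solution and has to be proved
(`IsDPPSolution.exists_abs_le`). A large value at `x` forces almost as large values on a fixed
portion of the `ε`-sphere around `x`, and again around those points. The sum of two independent
directions has an absolutely continuous law (`absolutelyContinuous_map_add`), so high superlevel
sets would keep a volume bounded below; but they lie in the bounded set `Ω` and decrease to the
empty set.

A solution exists as the limit of the increasing iterates of the equation started at `0`. A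
paraboloid bounds them, because Carol can answer any set `A` with `-A`, and `mid` is continuous in
`L¹`. -/

theorem σ_apply {N : ℕ} {s : Set (S N)} (hs : MeasurableSet s) :
    σ N s = N * volume (Set.Ioo (0 : ℝ) 1 • ((↑) '' s : Set (E N))) := by
  rw [σ, Measure.toSphere_apply' _ hs]
  simp

/-- The cone over a point lies in a line, a proper subspace because `N ≥ 2`. -/
theorem nullSingletonClass_σ {N : ℕ} (hN : 2 ≤ N) : NullSingletonClass (σ N) := by
  refine ⟨fun v => ?_⟩
  rw [σ_apply (measurableSet_singleton v)]
  have h : Set.Ioo (0 : ℝ) 1 • ((↑) '' ({v} : Set (S N)) : Set (E N)) ⊆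
      (Submodule.span ℝ {(v : E N)} : Submodule ℝ (E N)) := by
    rintro _ ⟨r, -, _, ⟨w, hw, rfl⟩, rfl⟩
    rw [Set.mem_singleton_iff.1 hw]
    exact Submodule.smul_mem _ _ (Submodule.mem_span_singleton_self _)
  have hne : (Submodule.span ℝ {(v : E N)} : Submodule ℝ (E N)) ≠ ⊤ := by
    intro h
    have h1 := finrank_span_le_card (R := ℝ) ({(v : E N)} : Set (E N))
    rw [h, finrank_top] at h1
    simp at h1
    omega
  rw [measure_mono_null h (Measure.addHaar_submodule _ _ hne), mul_zero]

theorem measurePreserving_neg_σ (N : ℕ) : MeasurePreserving (fun v : S N => -v) (σ N) (σ N) := by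
  have hneg : Measurable fun v : S N => -v := by fun_prop
  refine ⟨hneg, ?_⟩
  ext s hs
  rw [Measure.map_apply hneg hs, σ_apply hs, σ_apply (hneg hs)]
  congr 1
  rw [← Measure.measure_neg volume]
  congr 1
  ext x
  simp only [Set.mem_neg, Set.mem_smul, Set.mem_image, Set.mem_preimage]
  constructor
  · rintro ⟨r, hr, _, ⟨w, hw, rfl⟩, h⟩
    exact ⟨r, hr, _, ⟨-w, hw, rfl⟩, by simp [h]⟩
  · rintro ⟨r, hr, _, ⟨w, hw, rfl⟩, h⟩
    exact ⟨r, hr, _, ⟨-w, by simpa using hw, rfl⟩, by simp [h]⟩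

/-- The direction of a nonzero vector. -/
def dir {N : ℕ} (hN : 2 ≤ N) (y : E N) : S N :=
  -- The value at the origin, a null point, is arbitrary.
  if h : y = 0 then ⟨EuclideanSpace.single ⟨0, by omega⟩ 1, by simp⟩
  else ⟨‖y‖⁻¹ • y, by simp [norm_smul, h]⟩

theorem coe_dir {N : ℕ} (hN : 2 ≤ N) {y : E N} (hy : y ≠ 0) : (dir hN y : E N) = ‖y‖⁻¹ • y := by
  simp [dir, hy]

theorem dir_smul {N : ℕ} (hN : 2 ≤ N) {r : ℝ} (hr : 0 < r) (v : S N) :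
    dir hN (r • (v : E N)) = v := by
  have hv : ‖(v : E N)‖ = 1 := by simp
  have h : r • (v : E N) ≠ 0 := smul_ne_zero hr.ne' (by intro h; simp [h] at hv)
  ext1
  rw [coe_dir hN h, norm_smul, hv, smul_smul, Real.norm_of_nonneg hr.le]
  simp [hr.ne']

/-- A set of directions is null as soon as the cone over it is null. -/
theorem σ_eq_zero_of_cone {N : ℕ} (hN : 2 ≤ N) {s : Set (S N)} (hs : MeasurableSet s)
    (h : volume {y : E N | dir hN y ∈ s} = 0) : σ N s = 0 := by
  rw [σ_apply hs, measure_mono_null _ h, mul_zero]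
  rintro _ ⟨r, hr, _, ⟨w, hw, rfl⟩, rfl⟩
  simpa [dir_smul hN hr.1] using hw

theorem norm_sub_sq_of_unit {N : ℕ} (v w : S N) :
    ‖(v : E N) + w‖ ^ 2 + ‖(v : E N) - w‖ ^ 2 = 4 := by
  have h := parallelogram_law_with_norm ℝ (v : E N) (w : E N)
  simp at h
  nlinarith [h]

/-- The pair `(y, z)` can be recovered by a differentiable map `Φ` from `e = v + w` and one further
vector of `E N`, where `v`, `w` are the directions of `y`, `z`. The component of that vector along
`e` encodes `‖y‖`; its orthogonal component `q` has the direction of `v - w` and length `‖z‖`.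
Source and target have the same dimension, so `Φ` sends the null set `D ⊆ Z ×ˢ univ` to a null set.
-/
theorem volume_prod_dir_add_dir {N : ℕ} (hN : 2 ≤ N) {Z : Set (E N)} (hZ : volume Z = 0) :
    volume {p : E N × E N | p.1 ≠ 0 ∧ p.2 ≠ 0 ∧ (dir hN p.1 : E N) + dir hN p.2 ∈ Z ∧
      (dir hN p.1 : E N) + dir hN p.2 ≠ 0 ∧ (dir hN p.1 : E N) - dir hN p.2 ≠ 0} = 0 := by
  let a : E N × E N → ℝ := fun p => inner ℝ p.2 p.1
  let q : E N × E N → E N := fun p => p.2 - (a p / inner ℝ p.1 p.1) • p.1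
  let h : E N × E N → ℝ := fun p => Real.sqrt (1 - inner ℝ p.1 p.1 / 4)
  let Φ : E N × E N → E N × E N := fun p =>
    (a p • ((1 / 2 : ℝ) • p.1 + (h p * ‖q p‖⁻¹) • q p),
      ‖q p‖ • ((1 / 2 : ℝ) • p.1 - (h p * ‖q p‖⁻¹) • q p))
  let D : Set (E N × E N) := {p | p.1 ∈ Z ∧ inner ℝ p.1 p.1 ≠ (0 : ℝ) ∧ q p ≠ 0 ∧
    1 - (inner ℝ p.1 p.1 : ℝ) / 4 ≠ 0}
  have hD : volume D = 0 := by
    refine measure_mono_null (t := Z ×ˢ Set.univ) (fun p hp => ⟨hp.1, trivial⟩) ?_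
    rw [Measure.volume_eq_prod, Measure.prod_prod, hZ, zero_mul]
  have hΦ : DifferentiableOn ℝ Φ D := by
    intro p hp
    apply DifferentiableAt.differentiableWithinAt
    have ha : DifferentiableAt ℝ a p := by
      exact differentiableAt_snd.inner ℝ differentiableAt_fst
    have hb : DifferentiableAt ℝ (fun p : E N × E N => (inner ℝ p.1 p.1 : ℝ)) p :=
      differentiableAt_fst.inner ℝ differentiableAt_fst
    have hq : DifferentiableAt ℝ q p := by
      simp only [q]
      have hi : DifferentiableAt ℝ (fun p : E N × E N => (inner ℝ p.1 p.1 : ℝ)⁻¹) p :=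
        hb.inv hp.2.1
      simp only [div_eq_mul_inv]
      fun_prop
    have hh : DifferentiableAt ℝ h p := by
      simp only [h]
      exact DifferentiableAt.sqrt (by fun_prop) hp.2.2.2
    have hn : DifferentiableAt ℝ (fun p => ‖q p‖) p := hq.norm ℝ hp.2.2.1
    have hi : DifferentiableAt ℝ (fun p => ‖q p‖⁻¹) p := hn.inv (norm_ne_zero_iff.2 hp.2.2.1)
    simp only [Φ]
    fun_prop
  have : (volume : Measure (E N × E N)).IsAddHaarMeasure :=
    inferInstanceAs ((volume : Measure (E N)).prod volume).IsAddHaarMeasure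
  refine measure_mono_null ?_
    (addHaar_image_eq_zero_of_differentiableOn_of_addHaar_eq_zero volume hΦ hD)
  rintro ⟨y, z⟩ ⟨hy, hz, hZ, hs, hd⟩
  simp only at hy hz hZ hs hd
  set v := dir hN y with hv
  set w := dir hN z with hw
  have hv1 : ‖(v : E N)‖ = 1 := by simp
  have hw1 : ‖(w : E N)‖ = 1 := by simp
  have hyv : y = ‖y‖ • (v : E N) := by
    rw [hv, coe_dir hN hy, smul_smul, mul_inv_cancel₀ (norm_ne_zero_iff.2 hy), one_smul]
  have hzw : z = ‖z‖ • (w : E N) := by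
    rw [hw, coe_dir hN hz, smul_smul, mul_inv_cancel₀ (norm_ne_zero_iff.2 hz), one_smul]
  set e := (v : E N) + w with he
  set f := (v : E N) - w with hf
  have hef : inner ℝ f e = (0 : ℝ) := by
    rw [he, hf, inner_sub_left, inner_add_right, inner_add_right, real_inner_self_eq_norm_sq,
      real_inner_self_eq_norm_sq, hv1, hw1, real_inner_comm]
    ring
  have hee : (inner ℝ e e : ℝ) = ‖e‖ ^ 2 := real_inner_self_eq_norm_sq e
  have hsum : ‖e‖ ^ 2 + ‖f‖ ^ 2 = 4 := norm_sub_sq_of_unit v w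
  have he0 : ‖e‖ ≠ 0 := norm_ne_zero_iff.2 hs
  have hf0 : ‖f‖ ≠ 0 := norm_ne_zero_iff.2 hd
  have hz0 : ‖z‖ ≠ 0 := norm_ne_zero_iff.2 hz
  -- The coefficients are chosen so that `a p = ‖y‖` and `‖q p‖ = ‖z‖`; the parallelogram law then
  -- gives `h p = ‖f‖ / 2`.
  let p : E N × E N := (e, (‖z‖ / ‖f‖) • f + (‖y‖ / ‖e‖ ^ 2) • e)
  have hap : a p = ‖y‖ := by
    simp only [a, p, inner_add_left, inner_smul_left, hef, hee]
    simp; field_simp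
  have hqp : q p = (‖z‖ / ‖f‖) • f := by
    simp only [q, hap]
    simp only [p, hee]
    abel
  have hqn : ‖q p‖ = ‖z‖ := by
    rw [hqp, norm_smul, norm_div, norm_norm, norm_norm]; field_simp
  have hhp : h p = ‖f‖ / 2 := by
    simp only [h, p, hee]
    rw [show 1 - ‖e‖ ^ 2 / 4 = (‖f‖ / 2) ^ 2 by linarith, Real.sqrt_sq (by positivity)]
  have hco : (h p * ‖q p‖⁻¹) • q p = (1 / 2 : ℝ) • f := by
    rw [hhp, hqn, hqp, smul_smul]
    congr 1
    field_simp
  refine ⟨p, ⟨hZ, ?_, ?_, ?_⟩, ?_⟩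
  · simp only [p, hee]; positivity
  · rw [← norm_ne_zero_iff, hqn]; exact hz0
  · simp only [p, hee]
    have : 0 < ‖f‖ ^ 2 := by positivity
    intro h; linarith
  · change (a p • ((1 / 2 : ℝ) • e + (h p * ‖q p‖⁻¹) • q p),
      ‖q p‖ • ((1 / 2 : ℝ) • e - (h p * ‖q p‖⁻¹) • q p)) = (y, z)
    have h1 : (1 / 2 : ℝ) • e + (1 / 2 : ℝ) • f = v := by rw [he, hf]; module
    have h2 : (1 / 2 : ℝ) • e - (1 / 2 : ℝ) • f = w := by rw [he, hf]; module
    rw [hco, hap, hqn, h1, h2, ← hyv, ← hzw]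

/-- The convolution square of the surface measure is absolutely continuous. -/
theorem absolutelyContinuous_map_add {N : ℕ} (hN : 2 ≤ N) :
    ((σ N).prod (σ N)).map (fun p : S N × S N => (p.1 : E N) + p.2) ≪ volume := by
  have hna := nullSingletonClass_σ hN
  have hm : Measurable fun p : S N × S N => (p.1 : E N) + p.2 := by fun_prop
  refine Measure.AbsolutelyContinuous.mk fun Z hZm hZ => ?_
  rw [Measure.map_apply hm hZm]
  have hm' : Measurable fun p : S N × S N => (p.1 : E N) - p.2 := by fun_prop
  let R : Set (S N × S N) := {p | (p.1 : E N) + p.2 ∈ Z ∧ (p.1 : E N) + p.2 ≠ 0 ∧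
    (p.1 : E N) - p.2 ≠ 0}
  have hR : MeasurableSet R := by
    refine (hm hZm).inter (MeasurableSet.inter ?_ ?_)
    · exact (hm (measurableSet_singleton 0)).compl
    · exact (hm' (measurableSet_singleton 0)).compl
  have hnt : Nontrivial (E N) := by
    have : Nonempty (Fin N) := ⟨⟨0, by omega⟩⟩
    infer_instance
  have hR0 : (σ N).prod (σ N) R = 0 := by
    rw [Measure.measure_prod_null hR]
    have hmeas : Measurable fun v => σ N (Prod.mk v ⁻¹' R) := measurable_measure_prodMk_left hR
    refine σ_eq_zero_of_cone hN (s := {v | ¬ σ N (Prod.mk v ⁻¹' R) = 0})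
      (hmeas (measurableSet_singleton 0)).compl ?_
    -- Fubini slices the null set of pairs of vectors; passing to cones in each variable turns this
    -- into a statement about pairs of directions.
    have key := volume_prod_dir_add_dir hN hZ
    rw [Measure.volume_eq_prod] at key
    have key' := Measure.ae_ae_of_ae_prod (measure_eq_zero_iff_ae_notMem.1 key)
    have : ∀ᵐ y : E N, y ≠ 0 := by
      rw [ae_iff]; simp
    rw [measure_eq_zero_iff_ae_notMem]
    filter_upwards [key', this] with y hy hy0
    refine not_not.2 ?_
    refine σ_eq_zero_of_cone hN (measurable_prodMk_left hR) ?_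
    rw [measure_eq_zero_iff_ae_notMem]
    filter_upwards [hy, this] with z hz hz0 hmem
    exact hz ⟨hy0, hz0, hmem⟩
  have hdiag : (σ N).prod (σ N) ((fun p : S N × S N => (p.1 : E N) + p.2) ⁻¹' {0}) = 0 := by
    rw [Measure.measure_prod_null (hm (measurableSet_singleton 0))]
    refine Filter.Eventually.of_forall fun v => ?_
    refine measure_mono_null (t := {-v}) ?_ (measure_singleton _)
    intro w hw
    ext1
    exact (neg_eq_of_add_eq_zero_right hw).symm
  have hdiag' : (σ N).prod (σ N) ((fun p : S N × S N => (p.1 : E N) - p.2) ⁻¹' {0}) = 0 := by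
    rw [Measure.measure_prod_null (hm' (measurableSet_singleton 0))]
    refine Filter.Eventually.of_forall fun v => ?_
    refine measure_mono_null (t := {v}) ?_ (measure_singleton _)
    intro w hw
    ext1
    exact (sub_eq_zero.1 hw).symm
  refine measure_mono_null (t := R ∪ (((fun p : S N × S N => (p.1 : E N) + p.2) ⁻¹' {0}) ∪
    ((fun p : S N × S N => (p.1 : E N) - p.2) ⁻¹' {0}))) ?_
    (measure_union_null hR0 (measure_union_null hdiag hdiag'))
  intro p hp
  by_cases h1 : (p.1 : E N) + p.2 = 0
  · exact Or.inr (Or.inl h1)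
  by_cases h2 : (p.1 : E N) - p.2 = 0
  · exact Or.inr (Or.inr h2)
  exact Or.inl ⟨hp, h1, h2⟩

end SphereGame
end

/-! ### Uniform ranks and the saddle point of one round -/

noncomputable section

namespace SphereGame

section Rank

variable {α : Type*} [MeasurableSpace α] {μ : Measure α} [IsFiniteMeasure μ] [NullSingletonClass μ]
  [MeasurableEq α] {r : α → α → Prop}

/-- For a measurable strict total order and a measure without atoms, the points whose set of
predecessors has measure at most `c` form a set of measure at most `c`. -/
theorem measure_setOf_measure_predecessors_le (hr : MeasurableSet {p : α × α | r p.1 p.2})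
    (htrans : ∀ a b c, r a b → r b c → r a c) (htri : ∀ a b, r a b ∨ a = b ∨ r b a) (c : ℝ≥0∞) :
    μ {v | μ {w | r w v} ≤ c} ≤ c := by
  have hρ : Measurable fun v => μ {w | r w v} := measurable_measure_prodMk_right hr
  have hpre : ∀ v, MeasurableSet {w | r w v} := fun v => measurable_prodMk_right hr
  set L := {v | μ {w | r w v} ≤ c} with hL
  have hLm : MeasurableSet L := measurableSet_le hρ measurable_const
  rcases L.eq_empty_or_nonempty with h0 | hne
  · simp [h0]
  obtain ⟨u, -, hu, huS⟩ := exists_seq_tendsto_sSup (hne.image fun v => μ {w | r w v})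
    (OrderTop.bddAbove _)
  choose x hxL hxu using huS
  have hsub : ∀ a b, ¬ r b a → {w | r w a} ⊆ {w | r w b} := by
    intro a b hab w hw
    rcases htri a b with h | h | h
    · exact htrans _ _ _ hw h
    · exact h ▸ hw
    · exact absurd h hab
  -- The sets of predecessors form a chain, so `U` still has measure at most `c`, and no point of
  -- `L` has predecessors of larger total measure than `U`.
  set U := ⋃ n, {w | r w (x n)} with hU
  have hUm : MeasurableSet U := MeasurableSet.iUnion fun n => hpre _
  have hdir : Directed (· ⊆ ·) fun n => {w | r w (x n)} := by
    intro i j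
    by_cases h : r (x j) (x i)
    · exact ⟨i, subset_rfl, fun w hw => htrans _ _ _ hw h⟩
    · exact ⟨j, hsub _ _ h, subset_rfl⟩
  have hUc : μ U ≤ c := by
    rw [hU, hdir.measure_iUnion]
    exact iSup_le fun n => hxL n
  have hsU : ∀ v ∈ L, μ {w | r w v} ≤ μ U := by
    intro v hv
    refine (le_sSup (Set.mem_image_of_mem (fun v => μ {w | r w v}) hv)).trans ?_
    refine le_of_tendsto' hu fun n => ?_
    rw [← hxu n]
    exact measure_mono (Set.subset_iUnion (fun n => {w | r w (x n)}) n)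
  -- Every point of `Z` succeeds all of `U`, so its predecessors outside `U` are null. By trichotomy
  -- `Z ×ˢ Z` is then covered by two null sets and the diagonal, which is null for want of atoms.
  set Z := L \ U with hZ
  have hZm : MeasurableSet Z := hLm.diff hUm
  have hnull : ∀ v ∈ Z, μ {w | w ∈ Z ∧ r w v} = 0 := by
    intro v hv
    have hUv : U ⊆ {w | r w v} := by
      refine Set.iUnion_subset fun n => hsub _ _ fun h => hv.2 (Set.mem_iUnion.2 ⟨n, h⟩)
    refine measure_mono_null (t := {w | r w v} \ U) (fun w hw => ⟨hw.2, hw.1.2⟩) ?_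
    rw [measure_sdiff hUv hUm.nullMeasurableSet (measure_ne_top _ _), tsub_eq_zero_iff_le]
    exact hsU v hv.1
  have hZ0 : μ Z = 0 := by
    have h1 : (μ.prod μ) ((Z ×ˢ Z) ∩ {p | r p.1 p.2}) = 0 := by
      rw [Measure.prod_apply_symm ((hZm.prod hZm).inter hr), lintegral_eq_zero_iff
        (measurable_measure_prodMk_right ((hZm.prod hZm).inter hr))]
      refine Filter.Eventually.of_forall fun y => ?_
      by_cases hy : y ∈ Z
      · exact measure_mono_null (t := {w | w ∈ Z ∧ r w y}) (fun w hw => ⟨hw.1.1, hw.2⟩) (hnull y hy)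
      · exact measure_mono_null (t := ∅) (fun w hw => hy hw.1.2) measure_empty
    have hr' : MeasurableSet {p : α × α | r p.2 p.1} := measurable_swap hr
    have h2 : (μ.prod μ) ((Z ×ˢ Z) ∩ {p | r p.2 p.1}) = 0 := by
      rw [Measure.measure_prod_null ((hZm.prod hZm).inter hr')]
      refine Filter.Eventually.of_forall fun y => ?_
      by_cases hy : y ∈ Z
      · exact measure_mono_null (t := {w | w ∈ Z ∧ r w y}) (fun w hw => ⟨hw.1.2, hw.2⟩) (hnull y hy)
      · exact measure_mono_null (t := ∅) (fun w hw => hy hw.1.1) measure_empty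
    have h3 : (μ.prod μ) (Set.diagonal α) = 0 := by
      rw [Measure.measure_prod_null measurableSet_diagonal]
      refine Filter.Eventually.of_forall fun y => ?_
      refine measure_mono_null (t := {y}) (fun w hw => ?_) (measure_singleton y)
      exact (Set.mem_diagonal_iff.1 hw).symm
    have h4 : (μ.prod μ) (Z ×ˢ Z) = 0 := by
      refine measure_mono_null ?_ (measure_union_null h1 (measure_union_null h2 h3))
      rintro ⟨a, b⟩ hab
      rcases htri a b with h | h | h
      · exact Or.inl ⟨hab, h⟩
      · exact Or.inr (Or.inr h)
      · exact Or.inr (Or.inl ⟨hab, h⟩)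
    rw [Measure.prod_prod] at h4
    exact mul_self_eq_zero.1 h4
  calc μ L ≤ μ (U ∪ Z) := measure_mono fun v hv => by
        by_cases h : v ∈ U
        · exact Or.inl h
        · exact Or.inr ⟨hv, h⟩
    _ ≤ μ U + μ Z := measure_union_le _ _
    _ ≤ c := by rw [hZ0, add_zero]; exact hUc

/-- The measure of the set of predecessors is a uniformly distributed random variable. -/
theorem measure_setOf_measure_predecessors_lt (hr : MeasurableSet {p : α × α | r p.1 p.2})
    (hirr : ∀ a, ¬ r a a) (htrans : ∀ a b c, r a b → r b c → r a c)
    (htri : ∀ a b, r a b ∨ a = b ∨ r b a) {c : ℝ≥0∞} (hc : c ≤ μ Set.univ) :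
    μ {v | μ {w | r w v} < c} = c := by
  have hρ : Measurable fun v => μ {w | r w v} := measurable_measure_prodMk_right hr
  have hpre : ∀ v, MeasurableSet {w | r w v} := fun v => measurable_prodMk_right hr
  have hm : MeasurableSet {v | μ {w | r w v} < c} := measurableSet_lt hρ measurable_const
  have hsub : {v | μ {w | r w v} < c} ⊆ {v | μ {w | r w v} ≤ c} := by
    intro v (hv : μ {w | r w v} < c)
    exact hv.le
  refine le_antisymm ((measure_mono hsub).trans
    (measure_setOf_measure_predecessors_le hr htrans htri c)) ?_
  -- The lower bound is the upper bound for the reversed order, with the complementary threshold.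
  have h1 := measure_setOf_measure_predecessors_le (μ := μ) (r := fun a b => r b a)
    (measurable_swap hr) (fun a b c h h' => htrans _ _ _ h' h)
    (fun a b => (htri b a).imp id (Or.imp Eq.symm id)) (μ Set.univ - c)
  have h2 : {v | μ {w | r w v} < c}ᶜ ⊆ {v | μ {w | r v w} ≤ μ Set.univ - c} := by
    intro v hv
    have hv' : c ≤ μ {w | r w v} := not_lt.1 hv
    refine (measure_mono (t := {w | r w v}ᶜ)
      fun w (hw : r v w) (hw' : r w v) => hirr _ (htrans _ _ _ hw hw')).trans ?_
    rw [measure_compl (hpre v) (measure_ne_top _ _)]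
    exact tsub_le_tsub_left hv' _
  have h3 := (measure_mono h2).trans h1
  rw [measure_compl hm (measure_ne_top _ _)] at h3
  exact (ENNReal.sub_le_sub_iff_left hc (measure_ne_top _ _)).1 h3

end Rank

/-- Averages increase when points with small values are replaced by points with large values. -/
theorem setAverage_le_setAverage {α : Type*} [MeasurableSpace α] {μ : Measure α}
    [IsFiniteMeasure μ] {f : α → ℝ} (hf : Integrable f μ) {D X : Set α} (hD : MeasurableSet D)
    (hX : MeasurableSet X) (h0 : 0 < μ.real D) (hDX : μ.real D ≤ μ.real X) {t : ℝ}
    (h1 : ∀ v ∈ D, f v ≤ t) (h2 : ∀ v ∈ X \ D, t ≤ f v) :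
    ⨍ v in D, f v ∂μ ≤ ⨍ v in X, f v ∂μ := by
  have hg : Integrable (fun v => f v - t) μ := hf.sub (integrable_const t)
  have e : ∀ s, ∫ v in s, (f v - t) ∂μ = ∫ v in s, f v ∂μ - t * μ.real s := by
    intro s
    rw [integral_sub hf.integrableOn (integrable_const t)]
    simp [mul_comm]
  have a1 := integral_inter_add_sdiff hD (hg.integrableOn (s := X))
  have a2 := integral_inter_add_sdiff hX (hg.integrableOn (s := D))
  have a3 : 0 ≤ ∫ v in X \ D, (f v - t) ∂μ :=
    setIntegral_nonneg (hX.diff hD) fun v hv => sub_nonneg.2 (h2 v hv)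
  have a4 : ∫ v in D \ X, (f v - t) ∂μ ≤ 0 :=
    setIntegral_nonpos (hD.diff hX) fun v hv => sub_nonpos.2 (h1 v hv.1)
  have a5 : ∫ v in D, (f v - t) ∂μ ≤ 0 :=
    setIntegral_nonpos hD fun v hv => sub_nonpos.2 (h1 v hv)
  rw [Set.inter_comm] at a2
  rw [e X] at a1
  rw [e D] at a2 a5
  rw [setAverage_eq, setAverage_eq, smul_eq_mul, smul_eq_mul, inv_mul_eq_div, inv_mul_eq_div,
    div_le_div_iff₀ h0 (h0.trans_le hDX)]
  have a6 : ∫ v in D, f v ∂μ + t * (μ.real X - μ.real D) ≤ ∫ v in X, f v ∂μ := by linarith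
  nlinarith [mul_le_mul_of_nonneg_right a6 h0.le, mul_nonneg (sub_nonneg.2 hDX) (neg_nonneg.2 a5)]

theorem setAverage_le_setAverage' {α : Type*} [MeasurableSpace α] {μ : Measure α}
    [IsFiniteMeasure μ] {f : α → ℝ} (hf : Integrable f μ) {D X : Set α} (hD : MeasurableSet D)
    (hX : MeasurableSet X) (h0 : 0 < μ.real D) (hDX : μ.real D ≤ μ.real X) {t : ℝ}
    (h1 : ∀ v ∈ D, t ≤ f v) (h2 : ∀ v ∈ X \ D, f v ≤ t) :
    ⨍ v in X, f v ∂μ ≤ ⨍ v in D, f v ∂μ := by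
  have h := setAverage_le_setAverage (f := fun v => - f v) hf.neg hD hX h0 hDX (t := -t)
    (fun v hv => neg_le_neg (h1 v hv)) (fun v hv => neg_le_neg (h2 v hv))
  simpa [average_neg] using h

instance (N : ℕ) : StandardBorelSpace (S N) := by
  have : PolishSpace (S N) := Metric.isClosed_sphere.polishSpace
  infer_instance

/-- The directions that come before `v` in the order given by the values of `f`, where ties are
broken by an auxiliary measurable injection into the real numbers. -/
def below {N : ℕ} (f : S N → ℝ) (v : S N) : Set (S N) :=
  {w | f w < f v ∨ f w = f v ∧ embeddingReal (S N) w < embeddingReal (S N) v}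

/-- The surface measure of the set of directions that come before `v`. -/
def rank {N : ℕ} (f : S N → ℝ) (v : S N) : ℝ := (σ N).real (below f v)

/-- The optimal choice of Paul in one round with payoff `f`. -/
def topSet {N : ℕ} (δ : ℝ) (f : S N → ℝ) : Set (S N) :=
  {v | (1 / 2) * (σ N).real Set.univ - δ ≤ rank f v}

/-- The optimal choice of Carol in one round with payoff `f`. -/
def botSet {N : ℕ} (δ : ℝ) (f : S N → ℝ) : Set (S N) :=
  {v | rank f v < (1 / 2) * (σ N).real Set.univ + δ}

/-- The value of one round with payoff `f`. -/
def mid {N : ℕ} (δ : ℝ) (f : S N → ℝ) : ℝ := ⨍ v in topSet δ f ∩ botSet δ f, f v ∂(σ N)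

variable {N : ℕ} {δ : ℝ}

theorem measurable_rank_prod {X : Type*} [MeasurableSpace X] {f : X → S N → ℝ}
    (hf : Measurable (Function.uncurry f)) : Measurable fun p : X × S N => rank (f p.1) p.2 := by
  have he : Measurable (embeddingReal (S N)) := (measurableEmbedding_embeddingReal (S N)).measurable
  have h1 : Measurable fun q : (X × S N) × S N => f q.1.1 q.2 :=
    hf.comp (by fun_prop : Measurable fun q : (X × S N) × S N => (q.1.1, q.2))
  have h2 : Measurable fun q : (X × S N) × S N => f q.1.1 q.1.2 :=
    hf.comp (by fun_prop : Measurable fun q : (X × S N) × S N => (q.1.1, q.1.2))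
  have h : MeasurableSet {q : (X × S N) × S N | q.2 ∈ below (f q.1.1) q.1.2} :=
    (measurableSet_lt h1 h2).union ((measurableSet_eq_fun h1 h2).inter
      (measurableSet_lt (he.comp measurable_snd) (he.comp (measurable_snd.comp measurable_fst))))
  exact (measurable_measure_prodMk_left (ν := σ N) h).ennreal_toReal

theorem measurableSet_prod_topSet {X : Type*} [MeasurableSpace X] {f : X → S N → ℝ}
    (hf : Measurable (Function.uncurry f)) :
    MeasurableSet {p : X × S N | p.2 ∈ topSet δ (f p.1)} :=
  measurableSet_le measurable_const (measurable_rank_prod hf)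

theorem measurableSet_prod_botSet {X : Type*} [MeasurableSpace X] {f : X → S N → ℝ}
    (hf : Measurable (Function.uncurry f)) :
    MeasurableSet {p : X × S N | p.2 ∈ botSet δ (f p.1)} :=
  measurableSet_lt (measurable_rank_prod hf) measurable_const

theorem measurable_rank {f : S N → ℝ} (hf : Measurable f) : Measurable (rank f) := by
  have h := measurable_rank_prod (X := Unit) (f := fun _ => f) (hf.comp measurable_snd)
  exact h.comp (by fun_prop : Measurable fun v : S N => ((), v))

theorem measurableSet_topSet {f : S N → ℝ} (hf : Measurable f) : MeasurableSet (topSet δ f) :=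
  measurableSet_le measurable_const (measurable_rank hf)

theorem measurableSet_botSet {f : S N → ℝ} (hf : Measurable f) : MeasurableSet (botSet δ f) :=
  measurableSet_lt (measurable_rank hf) measurable_const

theorem le_of_rank_lt {f : S N → ℝ} {v w : S N} (h : rank f v < rank f w) : f v ≤ f w := by
  by_contra! hlt
  refine h.not_ge (measureReal_mono fun z hz => Or.inl ?_)
  rcases hz with hz | hz
  · exact hz.trans hlt
  · exact hz.1.trans_lt hlt

/-- Breaking ties by an injection makes `below` a strict total order even where `f` is constant, so
that portions of the sphere can be cut off at any prescribed measure. -/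
theorem measureReal_rank_lt (hN : 2 ≤ N) {f : S N → ℝ} (hf : Measurable f) {c : ℝ} (hc : 0 ≤ c)
    (hc' : c ≤ (σ N).real Set.univ) : (σ N).real {v | rank f v < c} = c := by
  have := nullSingletonClass_σ hN
  have he : Measurable (embeddingReal (S N)) := (measurableEmbedding_embeddingReal (S N)).measurable
  have hinj := (measurableEmbedding_embeddingReal (S N)).injective
  have hr : MeasurableSet {p : S N × S N | p.1 ∈ below f p.2} :=
    (measurableSet_lt (hf.comp measurable_fst) (hf.comp measurable_snd)).union
      ((measurableSet_eq_fun (hf.comp measurable_fst) (hf.comp measurable_snd)).inter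
        (measurableSet_lt (he.comp measurable_fst) (he.comp measurable_snd)))
  have key := measure_setOf_measure_predecessors_lt (μ := σ N) (r := fun w v => w ∈ below f v) hr
    (fun a h => h.elim (lt_irrefl _) fun h => lt_irrefl _ h.2)
    (by
      rintro a b c (h | h) (h' | h')
      · exact Or.inl (h.trans h')
      · exact Or.inl (h.trans_eq h'.1)
      · exact Or.inl (h.1.trans_lt h')
      · exact Or.inr ⟨h.1.trans h'.1, h.2.trans h'.2⟩)
    (by
      intro a b
      rcases lt_trichotomy (f a) (f b) with h | h | h
      · exact Or.inl (Or.inl h)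
      · rcases lt_trichotomy (embeddingReal (S N) a) (embeddingReal (S N) b) with h' | h' | h'
        · exact Or.inl (Or.inr ⟨h, h'⟩)
        · exact Or.inr (Or.inl (hinj h'))
        · exact Or.inr (Or.inr (Or.inr ⟨h.symm, h'⟩))
      · exact Or.inr (Or.inr (Or.inl h)))
    (c := ENNReal.ofReal c) (ENNReal.ofReal_le_of_le_toReal hc')
  have hset : {v | rank f v < c} = {v | σ N {w | w ∈ below f v} < ENNReal.ofReal c} := by
    ext v
    exact (ENNReal.lt_ofReal_iff_toReal_lt (measure_ne_top _ _)).symm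
  rw [hset, Measure.real, key, ENNReal.toReal_ofReal hc]

theorem measureReal_botSet (hN : 2 ≤ N) (hδ : 0 < δ) (hδ' : δ < (1 / 2) * (σ N).real Set.univ)
    {f : S N → ℝ} (hf : Measurable f) :
    (σ N).real (botSet δ f) = (1 / 2) * (σ N).real Set.univ + δ :=
  measureReal_rank_lt hN hf (by positivity) (by linarith)

theorem measureReal_topSet_compl (hN : 2 ≤ N) (hδ : 0 < δ)
    (hδ' : δ < (1 / 2) * (σ N).real Set.univ) {f : S N → ℝ} (hf : Measurable f) :
    (σ N).real (topSet δ f)ᶜ = (1 / 2) * (σ N).real Set.univ - δ := by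
  rw [← measureReal_rank_lt hN hf (c := (1 / 2) * (σ N).real Set.univ - δ) (by linarith)
    (by linarith)]
  congr 1
  ext v
  exact not_le (a := (1 / 2) * (σ N).real Set.univ - δ) (b := rank f v)

theorem measureReal_topSet (hN : 2 ≤ N) (hδ : 0 < δ) (hδ' : δ < (1 / 2) * (σ N).real Set.univ)
    {f : S N → ℝ} (hf : Measurable f) :
    (σ N).real (topSet δ f) = (1 / 2) * (σ N).real Set.univ + δ := by
  have h := measureReal_topSet_compl hN hδ hδ' hf
  rw [measureReal_compl (measurableSet_topSet hf)] at h
  linarith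

theorem topSet_mem_admissible (hN : 2 ≤ N) (hδ : 0 < δ)
    (hδ' : δ < (1 / 2) * (σ N).real Set.univ) {f : S N → ℝ} (hf : Measurable f) :
    topSet δ f ∈ admissible N δ :=
  ⟨measurableSet_topSet hf, (measureReal_topSet hN hδ hδ' hf).ge⟩

theorem botSet_mem_admissible (hN : 2 ≤ N) (hδ : 0 < δ)
    (hδ' : δ < (1 / 2) * (σ N).real Set.univ) {f : S N → ℝ} (hf : Measurable f) :
    botSet δ f ∈ admissible N δ :=
  ⟨measurableSet_botSet hf, (measureReal_botSet hN hδ hδ' hf).ge⟩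

theorem measureReal_inter_ge {A B : Set (S N)} (hA : A ∈ admissible N δ)
    (hB : B ∈ admissible N δ) : 2 * δ ≤ (σ N).real (A ∩ B) := by
  have h1 := measureReal_union_add_inter (μ := σ N) (s := A) (t := B) hB.1
  have h2 : (σ N).real (A ∪ B) ≤ (σ N).real Set.univ := measureReal_mono (Set.subset_univ _)
  have h3 := hA.2
  have h4 := hB.2
  linarith

/-- The two portions cover the sphere, so their overlap is the smallest that `measureReal_inter_ge`
allows. -/
theorem measureReal_topSet_inter_botSet (hN : 2 ≤ N) (hδ : 0 < δ)
    (hδ' : δ < (1 / 2) * (σ N).real Set.univ) {f : S N → ℝ} (hf : Measurable f) :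
    (σ N).real (topSet δ f ∩ botSet δ f) = 2 * δ := by
  have h1 := measureReal_union_add_inter (μ := σ N) (s := topSet δ f) (t := botSet δ f)
    (measurableSet_botSet hf)
  have h2 : topSet δ f ∪ botSet δ f = Set.univ := by
    refine Set.eq_univ_of_forall fun v => ?_
    rcases le_or_gt ((1 / 2) * (σ N).real Set.univ - δ) (rank f v) with h | h
    · exact Or.inl h
    · exact Or.inr (h.trans (by linarith))
  rw [h2, measureReal_topSet hN hδ hδ' hf, measureReal_botSet hN hδ hδ' hf] at h1
  linarith

theorem mid_le_average (hN : 2 ≤ N) (hδ : 0 < δ) (hδ' : δ < (1 / 2) * (σ N).real Set.univ)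
    {f : S N → ℝ} (hf : Measurable f) (hi : Integrable f (σ N)) {B : Set (S N)}
    (hB : B ∈ admissible N δ) : mid δ f ≤ ⨍ v in topSet δ f ∩ B, f v ∂(σ N) := by
  have hD := measureReal_topSet_inter_botSet hN hδ hδ' hf
  have hbot := measureReal_botSet hN hδ hδ' hf
  -- The function `f` may be unbounded; a value outside `botSet` bounds it on `botSet`, so that the
  -- threshold `sSup` below is meaningful.
  obtain ⟨w, hw⟩ : (botSet δ f)ᶜ.Nonempty := by
    rw [Set.nonempty_compl]
    intro h
    rw [h] at hbot
    linarith
  have hlt : ∀ v ∈ botSet δ f, ∀ w ∉ botSet δ f, f v ≤ f w := fun v hv w hw =>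
    le_of_rank_lt (lt_of_lt_of_le hv (not_lt.1 hw))
  have hne : (f '' botSet δ f).Nonempty := by
    refine Set.Nonempty.image _ ?_
    rw [Set.nonempty_iff_ne_empty]
    intro h
    rw [h] at hbot
    simp at hbot
    linarith
  refine setAverage_le_setAverage hi ((measurableSet_topSet hf).inter (measurableSet_botSet hf))
    ((measurableSet_topSet hf).inter hB.1) (by rw [hD]; positivity)
    (hD.trans_le (measureReal_inter_ge (topSet_mem_admissible hN hδ hδ' hf) hB))
    (t := sSup (f '' botSet δ f)) ?_ ?_
  · intro v hv
    exact le_csSup ⟨f w, by rintro _ ⟨z, hz, rfl⟩; exact hlt z hz w hw⟩ ⟨v, hv.2, rfl⟩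
  · intro v hv
    refine csSup_le hne ?_
    rintro _ ⟨z, hz, rfl⟩
    exact hlt z hz v fun h => hv.2 ⟨hv.1.1, h⟩

theorem average_le_mid (hN : 2 ≤ N) (hδ : 0 < δ) (hδ' : δ < (1 / 2) * (σ N).real Set.univ)
    {f : S N → ℝ} (hf : Measurable f) (hi : Integrable f (σ N)) {A : Set (S N)}
    (hA : A ∈ admissible N δ) : ⨍ v in A ∩ botSet δ f, f v ∂(σ N) ≤ mid δ f := by
  have hD := measureReal_topSet_inter_botSet hN hδ hδ' hf
  have htop := measureReal_topSet hN hδ hδ' hf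
  obtain ⟨w, hw⟩ : (topSet δ f)ᶜ.Nonempty := by
    rw [Set.nonempty_compl]
    intro h
    rw [h] at htop
    linarith
  have hlt : ∀ v ∉ topSet δ f, ∀ w ∈ topSet δ f, f v ≤ f w := fun v hv w hw =>
    le_of_rank_lt (lt_of_lt_of_le (not_le.1 hv) hw)
  have hne : (f '' topSet δ f).Nonempty := by
    refine Set.Nonempty.image _ ?_
    rw [Set.nonempty_iff_ne_empty]
    intro h
    rw [h] at htop
    simp at htop
    linarith
  refine setAverage_le_setAverage' hi ((measurableSet_topSet hf).inter (measurableSet_botSet hf))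
    (hA.1.inter (measurableSet_botSet hf)) (by rw [hD]; positivity)
    (hD.trans_le (measureReal_inter_ge hA (botSet_mem_admissible hN hδ hδ' hf)))
    (t := sInf (f '' topSet δ f)) ?_ ?_
  · intro v hv
    exact csInf_le ⟨f w, by rintro _ ⟨z, hz, rfl⟩; exact hlt w hw z hz⟩ ⟨v, hv.1, rfl⟩
  · intro v hv
    refine le_csInf hne ?_
    rintro _ ⟨z, hz, rfl⟩
    exact hlt v (fun h => hv.2 ⟨h, hv.1.2⟩) z hz

/-- The overlap has measure at least `2δ`. The uniform bound makes the real-valued suprema and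
infima genuine, and it gives the Lipschitz constant of `mid`. -/
theorem abs_setAverage_le (hδ : 0 < δ) {f : S N → ℝ} (hi : Integrable f (σ N))
    {A B : Set (S N)} (hA : A ∈ admissible N δ) (hB : B ∈ admissible N δ) :
    |⨍ v in A ∩ B, f v ∂(σ N)| ≤ (2 * δ)⁻¹ * ∫ v, |f v| ∂(σ N) := by
  have h := measureReal_inter_ge hA hB
  rw [setAverage_eq, smul_eq_mul, abs_mul, abs_inv, abs_of_nonneg measureReal_nonneg]
  have h1 : |∫ v in A ∩ B, f v ∂(σ N)| ≤ ∫ v, |f v| ∂(σ N) :=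
    (abs_integral_le_integral_abs).trans
      (setIntegral_le_integral hi.abs (Filter.Eventually.of_forall fun v => abs_nonneg _))
  gcongr

/-- The one-round game has the value `mid δ f`. -/
theorem iSup_iInf_average (hN : 2 ≤ N) (hδ : 0 < δ) (hδ' : δ < (1 / 2) * (σ N).real Set.univ)
    {f : S N → ℝ} (hf : Measurable f) (hi : Integrable f (σ N)) :
    (⨆ A : admissible N δ, ⨅ B : admissible N δ,
      ⨍ v in (A : Set (S N)) ∩ (B : Set (S N)), f v ∂(σ N)) = mid δ f := by
  let A₀ : admissible N δ := ⟨topSet δ f, topSet_mem_admissible hN hδ hδ' hf⟩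
  let B₀ : admissible N δ := ⟨botSet δ f, botSet_mem_admissible hN hδ hδ' hf⟩
  have : Nonempty (admissible N δ) := ⟨A₀⟩
  have hle : ∀ A : admissible N δ, (⨅ B : admissible N δ,
      ⨍ v in (A : Set (S N)) ∩ (B : Set (S N)), f v ∂(σ N)) ≤ mid δ f := fun A =>
    (ciInf_le ⟨-((2 * δ)⁻¹ * ∫ v, |f v| ∂(σ N)), by
      rintro _ ⟨B, rfl⟩
      exact neg_le_of_abs_le (abs_setAverage_le hδ hi A.2 B.2)⟩ B₀).trans
        (average_le_mid hN hδ hδ' hf hi A.2)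
  refine le_antisymm (ciSup_le hle) ?_
  refine le_trans (le_ciInf fun B => ?_) (le_ciSup ⟨mid δ f, by rintro _ ⟨A, rfl⟩; exact hle A⟩ A₀)
  exact mid_le_average hN hδ hδ' hf hi B.2

end SphereGame
end

/-! ### Properties of the one-round value, and boundedness of solutions -/

noncomputable section

namespace SphereGame

variable {N : ℕ} {δ : ℝ}

/-- Both values are compared with averages over one set: Paul's optimal set for `f` met with Carol's
optimal set for `g`. The resulting `L¹` continuity carries the equation to limits. -/
theorem mid_le_mid_add (hN : 2 ≤ N) (hδ : 0 < δ) (hδ' : δ < (1 / 2) * (σ N).real Set.univ)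
    {f g : S N → ℝ} (hf : Measurable f) (hfi : Integrable f (σ N)) (hg : Measurable g)
    (hgi : Integrable g (σ N)) :
    mid δ f ≤ mid δ g + (2 * δ)⁻¹ * ∫ v, |f v - g v| ∂(σ N) := by
  have hA := topSet_mem_admissible hN hδ hδ' hf
  have hB := botSet_mem_admissible hN hδ hδ' hg
  have h1 := mid_le_average hN hδ hδ' hf hfi hB
  have h2 := average_le_mid hN hδ hδ' hg hgi hA
  have h3 := (abs_le.1 (abs_setAverage_le hδ (hfi.sub hgi) hA hB)).2
  simp only [Pi.sub_apply] at h3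
  have h4 : ⨍ v in topSet δ f ∩ botSet δ g, (f v - g v) ∂(σ N) =
      ⨍ v in topSet δ f ∩ botSet δ g, f v ∂(σ N) - ⨍ v in topSet δ f ∩ botSet δ g, g v ∂(σ N) := by
    simp only [setAverage_eq, smul_eq_mul]
    rw [integral_sub hfi.integrableOn hgi.integrableOn, mul_sub]
  linarith

theorem setAverage_mono {f g : S N → ℝ} (hfi : Integrable f (σ N)) (hgi : Integrable g (σ N))
    (hfg : ∀ v, f v ≤ g v) (X : Set (S N)) : ⨍ v in X, f v ∂(σ N) ≤ ⨍ v in X, g v ∂(σ N) := by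
  simp only [setAverage_eq, smul_eq_mul]
  have := integral_mono hfi.integrableOn (hgi.integrableOn (s := X)) hfg
  gcongr

theorem mid_mono (hN : 2 ≤ N) (hδ : 0 < δ) (hδ' : δ < (1 / 2) * (σ N).real Set.univ)
    {f g : S N → ℝ} (hf : Measurable f) (hfi : Integrable f (σ N)) (hg : Measurable g)
    (hgi : Integrable g (σ N)) (hfg : ∀ v, f v ≤ g v) : mid δ f ≤ mid δ g :=
  ((mid_le_average hN hδ hδ' hf hfi (botSet_mem_admissible hN hδ hδ' hg)).trans
    (setAverage_mono hfi hgi hfg _)).trans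
    (average_le_mid hN hδ hδ' hg hgi (topSet_mem_admissible hN hδ hδ' hf))

/-- The value of a round is at most `c` when the payoff is `c` plus an odd function. -/
theorem mid_const_add_odd_le (hN : 2 ≤ N) (hδ : 0 < δ) (hδ' : δ < (1 / 2) * (σ N).real Set.univ)
    {h : S N → ℝ} (hh : Measurable h) (hhi : Integrable h (σ N)) (hodd : ∀ v, h (-v) = - h v)
    (c : ℝ) : mid δ (fun v => c + h v) ≤ c := by
  have hf : Measurable fun v => c + h v := hh.const_add c
  have hfi : Integrable (fun v => c + h v) (σ N) := (integrable_const c).add hhi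
  set A := topSet δ fun v => c + h v
  have hA : A ∈ admissible N δ := topSet_mem_admissible hN hδ hδ' hf
  have hneg := measurePreserving_neg_σ N
  -- Carol answers with the reflection of Paul's set; the intersection is symmetric, so the odd part
  -- integrates to zero.
  have hB : (fun v : S N => -v) ⁻¹' A ∈ admissible N δ := by
    refine ⟨hneg.measurable hA.1, ?_⟩
    rw [hneg.measureReal_preimage hA.1.nullMeasurableSet]
    exact hA.2
  refine (mid_le_average hN hδ hδ' hf hfi hB).trans ?_
  set X := A ∩ (fun v : S N => -v) ⁻¹' A
  have hX : (fun v : S N => -v) ⁻¹' X = X := by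
    ext v
    simp [X, and_comm]
  have hemb : MeasurableEmbedding fun v : S N => -v :=
    (MeasurableEquiv.neg (S N)).measurableEmbedding
  have h0 : ∫ v in X, h v ∂(σ N) = 0 := by
    have h1 := hneg.setIntegral_preimage_emb hemb h X
    rw [hX] at h1
    simp only [hodd, integral_neg] at h1
    linarith
  have h2 := measureReal_inter_ge hA hB
  rw [setAverage_eq, integral_add (integrable_const c) hhi.integrableOn, h0, add_zero,
    setIntegral_const, smul_smul, inv_mul_cancel₀ (by linarith), one_smul]

theorem setAverage_le_of_forall_le {f : S N → ℝ} (hfi : Integrable f (σ N)) {X : Set (S N)}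
    (hX : MeasurableSet X) (h0 : 0 < (σ N).real X) {L : ℝ} (h : ∀ v ∈ X, f v ≤ L) :
    ⨍ v in X, f v ∂(σ N) ≤ L := by
  have h1 := setIntegral_mono_on hfi.integrableOn (integrable_const L).integrableOn hX h
  rw [setIntegral_const, smul_eq_mul] at h1
  rw [setAverage_eq, smul_eq_mul, inv_mul_le_iff₀ h0]
  exact h1

theorem le_setAverage_of_forall_le {f : S N → ℝ} (hfi : Integrable f (σ N)) {X : Set (S N)}
    (hX : MeasurableSet X) (h0 : 0 < (σ N).real X) {L : ℝ} (h : ∀ v ∈ X, L ≤ f v) :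
    L ≤ ⨍ v in X, f v ∂(σ N) := by
  have h1 := setIntegral_mono_on (integrable_const L).integrableOn hfi.integrableOn hX h
  rw [setIntegral_const, smul_eq_mul] at h1
  rw [setAverage_eq, smul_eq_mul, le_inv_mul_iff₀ h0]
  exact h1

/-- Otherwise the set where `f ≤ L` would be admissible, and Carol could choose it to keep the
average at most `L`. -/
theorem le_measureReal_of_lt_mid (hN : 2 ≤ N) (hδ : 0 < δ)
    (hδ' : δ < (1 / 2) * (σ N).real Set.univ) {f : S N → ℝ} (hf : Measurable f)
    (hfi : Integrable f (σ N)) {L : ℝ} (hL : L < mid δ f) :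
    (1 / 2) * (σ N).real Set.univ - δ ≤ (σ N).real {v | L < f v} := by
  by_contra! hlt
  have hm : MeasurableSet {v | L < f v} := measurableSet_lt measurable_const hf
  have hB : {v | L < f v}ᶜ ∈ admissible N δ := by
    refine ⟨hm.compl, ?_⟩
    rw [measureReal_compl hm]
    linarith
  have hA := topSet_mem_admissible hN hδ hδ' hf
  have h2 := measureReal_inter_ge hA hB
  refine hL.not_ge ((mid_le_average hN hδ hδ' hf hfi hB).trans ?_)
  exact setAverage_le_of_forall_le hfi (hA.1.inter hB.1) (by linarith) fun v hv => not_lt.1 hv.2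

theorem le_measureReal_of_mid_lt (hN : 2 ≤ N) (hδ : 0 < δ)
    (hδ' : δ < (1 / 2) * (σ N).real Set.univ) {f : S N → ℝ} (hf : Measurable f)
    (hfi : Integrable f (σ N)) {L : ℝ} (hL : mid δ f < L) :
    (1 / 2) * (σ N).real Set.univ - δ ≤ (σ N).real {v | f v < L} := by
  by_contra! hlt
  have hm : MeasurableSet {v | f v < L} := measurableSet_lt hf measurable_const
  have hA : {v | f v < L}ᶜ ∈ admissible N δ := by
    refine ⟨hm.compl, ?_⟩
    rw [measureReal_compl hm]
    linarith
  have hB := botSet_mem_admissible hN hδ hδ' hf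
  have h2 := measureReal_inter_ge hA hB
  refine hL.not_ge (le_trans ?_ (average_le_mid hN hδ hδ' hf hfi hA))
  exact le_setAverage_of_forall_le hfi (hA.1.inter hB.1) (by linarith) fun v hv => not_lt.1 hv.1

theorem measurable_mid {X : Type*} [MeasurableSpace X] {f : X → S N → ℝ}
    (hf : Measurable (Function.uncurry f)) : Measurable fun x => mid δ (f x) := by
  have hD : MeasurableSet {p : X × S N | p.2 ∈ topSet δ (f p.1) ∩ botSet δ (f p.1)} :=
    (measurableSet_prod_topSet hf).inter (measurableSet_prod_botSet hf)
  have hfx : ∀ x, Measurable (f x) := fun x => hf.comp measurable_prodMk_left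
  have h1 : ∀ x, mid δ (f x) =
      ((σ N).real (Prod.mk x ⁻¹' {p : X × S N | p.2 ∈ topSet δ (f p.1) ∩ botSet δ (f p.1)}))⁻¹ *
        ∫ v, ({p : X × S N | p.2 ∈ topSet δ (f p.1) ∩ botSet δ (f p.1)}.indicator
          (Function.uncurry f)) (x, v) ∂(σ N) := by
    intro x
    rw [mid, setAverage_eq, smul_eq_mul,
      ← integral_indicator ((measurableSet_topSet (hfx x)).inter (measurableSet_botSet (hfx x)))]
    rfl
  simp_rw [h1]
  refine Measurable.mul (measurable_measure_prodMk_left hD).ennreal_toReal.inv ?_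
  exact (hf.indicator hD).stronglyMeasurable.integral_prod_right'.measurable

/-- A function that is large on a definite portion of the sphere around any point where it is
large is bounded above. -/
theorem exists_forall_le_of_le_measureReal (hN : 2 ≤ N) {ε : ℝ} (hε : 0 < ε) {Ω : Set (E N)}
    (hbdd : Bornology.IsBounded Ω) {w : E N → ℝ} (hw : Measurable w) (hw0 : ∀ x ∉ Ω, w x = 0)
    {c θ : ℝ} (hc : 0 ≤ c) (hθ : 0 < θ)
    (H : ∀ x ∈ Ω, ∀ L, L + c < w x → θ ≤ (σ N).real {v : S N | L < w (x + ε • (v : E N))}) :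
    ∃ b, ∀ x, w x ≤ b := by
  by_contra! hcon
  set ν := ((σ N).prod (σ N)).map (fun p : S N × S N => (p.1 : E N) + p.2) with hν
  have hm : Measurable fun p : S N × S N => (p.1 : E N) + p.2 := by fun_prop
  have hac : ν ≪ volume := absolutelyContinuous_map_add hN
  have hθ' : ENNReal.ofReal θ * ENNReal.ofReal θ ≠ 0 := by simp [hθ]
  -- Absolute continuity: a set of volume below `η` has `ν`-measure below `θ²`, which two steps of
  -- `H` will contradict.
  obtain ⟨η, hη, hsmall⟩ := exists_pos_setLIntegral_lt_of_measure_lt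
    (μ := (volume : Measure (E N))) (f := ν.rnDeriv volume)
    (Measure.lintegral_rnDeriv_lt_top _ _).ne hθ'
  have hEm : ∀ n : ℕ, MeasurableSet {x | (n : ℝ) < w x} := fun n =>
    measurableSet_lt measurable_const hw
  have hEΩ : ∀ n : ℕ, {x | (n : ℝ) < w x} ⊆ Ω := by
    intro n x (hx : (n : ℝ) < w x)
    by_contra h
    rw [hw0 x h] at hx
    exact hx.not_ge n.cast_nonneg
  have hlim : Filter.Tendsto (fun n : ℕ => volume {x | (n : ℝ) < w x}) Filter.atTop
      (nhds 0) := by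
    have h := tendsto_measure_iInter_atTop (μ := (volume : Measure (E N)))
      (s := fun n : ℕ => {x | (n : ℝ) < w x}) (fun n => (hEm n).nullMeasurableSet)
      (fun m n hmn x (hx : (n : ℝ) < w x) => lt_of_le_of_lt (Nat.cast_le.2 hmn) hx)
      ⟨0, (measure_mono (hEΩ 0)).trans_lt hbdd.measure_lt_top |>.ne⟩
    have he : ⋂ n : ℕ, {x | (n : ℝ) < w x} = ∅ := by
      refine Set.eq_empty_of_forall_notMem fun x hx => ?_
      obtain ⟨n, hn⟩ := exists_nat_gt (w x)
      exact (Set.mem_iInter.1 hx n : (n : ℝ) < w x).not_gt hn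
    rwa [he, measure_empty] at h
  have hlim' := ENNReal.Tendsto.const_mul (a := ENNReal.ofReal |(ε ^ N)⁻¹|) hlim
    (Or.inr ENNReal.ofReal_ne_top)
  rw [mul_zero] at hlim'
  obtain ⟨n, hn⟩ := (hlim'.eventually_lt_const hη).exists
  -- Each of the two steps costs one `c`, leaving the level `n`.
  obtain ⟨x, hx⟩ := hcon (n + c + c)
  have hs : MeasurableSet {z : E N | (n : ℝ) < w (x + ε • z)} :=
    measurableSet_lt measurable_const (hw.comp (by fun_prop))
  have hvol : volume {z : E N | (n : ℝ) < w (x + ε • z)} < η := by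
    have h1 : {z : E N | (n : ℝ) < w (x + ε • z)} =
        (fun z => ε • z) ⁻¹' ((fun z => x + z) ⁻¹' {x | (n : ℝ) < w x}) := rfl
    rw [h1, Measure.addHaar_preimage_smul _ hε.ne', measure_preimage_add, finrank_euclideanSpace,
      Fintype.card_fin]
    exact hn
  have hlt := hsmall _ hvol
  rw [Measure.setLIntegral_rnDeriv hac, hν, Measure.map_apply hm hs,
    Measure.prod_apply (hm hs)] at hlt
  refine hlt.not_ge ?_
  have hmem : ∀ y, ∀ L, 0 ≤ L → L < w y → y ∈ Ω := by
    intro y L hL hy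
    by_contra h
    rw [hw0 y h] at hy
    linarith
  have hn0 : (0 : ℝ) ≤ n := n.cast_nonneg
  have hG := H x (hmem x (n + c + c) (by positivity) hx) (n + c) hx
  have hGm : MeasurableSet {v : S N | n + c < w (x + ε • (v : E N))} :=
    measurableSet_lt measurable_const (hw.comp (by fun_prop))
  calc ENNReal.ofReal θ * ENNReal.ofReal θ
      ≤ ENNReal.ofReal θ * σ N {v : S N | n + c < w (x + ε • (v : E N))} := by
        gcongr
        exact ENNReal.ofReal_le_of_le_toReal hG
    _ = ∫⁻ v in {v : S N | n + c < w (x + ε • (v : E N))}, ENNReal.ofReal θ ∂(σ N) := by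
        rw [setLIntegral_const]
    _ ≤ ∫⁻ v in {v : S N | n + c < w (x + ε • (v : E N))}, σ N (Prod.mk v ⁻¹'
          ((fun p : S N × S N => (p.1 : E N) + p.2) ⁻¹' {z | (n : ℝ) < w (x + ε • z)})) ∂(σ N) := by
        refine setLIntegral_mono' hGm fun v (hv : n + c < w (x + ε • (v : E N))) => ?_
        refine ENNReal.ofReal_le_of_le_toReal ?_
        have h := H _ (hmem _ (n + c) (by positivity) hv) n hv
        have hset : Prod.mk v ⁻¹' ((fun p : S N × S N => (p.1 : E N) + p.2) ⁻¹'
            {z | (n : ℝ) < w (x + ε • z)}) =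
            {v' : S N | (n : ℝ) < w (x + ε • (v : E N) + ε • (v' : E N))} := by
          ext v'
          simp [smul_add, add_assoc]
        rw [hset]
        exact h
    _ ≤ _ := setLIntegral_le_lintegral _ _

variable {ε K : ℝ} {Ω : Set (E N)}

theorem measurable_comp_step {w : E N → ℝ} (hw : Measurable w) (ε : ℝ) (x : E N) :
    Measurable fun v : S N => w (x + ε • (v : E N)) := hw.comp (by fun_prop)

theorem IsDPPSolution.eq_mid (hN : 2 ≤ N) (hδ : 0 < δ) (hδ' : δ < (1 / 2) * (σ N).real Set.univ)
    {w : E N → ℝ} (hw : IsDPPSolution ε δ K Ω w) {x : E N} (hx : x ∈ Ω) :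
    w x = mid δ (fun v : S N => w (x + ε • (v : E N))) + ε ^ 2 * K := by
  rw [hw.eq_of_mem x hx, iSup_iInf_average hN hδ hδ' (measurable_comp_step hw.measurable ε x)
    (hw.integrable x hx)]

/-- Solutions of the dynamic programming principle are bounded. -/
theorem IsDPPSolution.exists_abs_le (hN : 2 ≤ N) (hε : 0 < ε) (hδ : 0 < δ)
    (hδ' : δ < (1 / 2) * (σ N).real Set.univ) (hK : 0 < K) (hbdd : Bornology.IsBounded Ω)
    {w : E N → ℝ} (hw : IsDPPSolution ε δ K Ω w) : ∃ b, ∀ x, |w x| ≤ b := by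
  have hc : 0 ≤ ε ^ 2 * K := by positivity
  obtain ⟨b₁, h₁⟩ := exists_forall_le_of_le_measureReal hN hε hbdd hw.measurable hw.eq_zero hc
    (sub_pos.2 hδ') fun x hx L hL => le_measureReal_of_lt_mid hN hδ hδ'
      (measurable_comp_step hw.measurable ε x) (hw.integrable x hx) (by
        have := hw.eq_mid hN hδ hδ' hx
        linarith)
  -- For `-w` the running term has the favourable sign, so the same loss `c` is more than enough.
  obtain ⟨b₂, h₂⟩ := exists_forall_le_of_le_measureReal hN hε hbdd hw.measurable.neg
    (fun x hx => by simp [hw.eq_zero x hx]) hc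
    (sub_pos.2 hδ') fun x hx L hL => by
      have := le_measureReal_of_mid_lt hN hδ hδ' (measurable_comp_step hw.measurable ε x)
        (hw.integrable x hx) (L := -L) (by
          have := hw.eq_mid hN hδ hδ' hx
          simp only [Pi.neg_apply] at hL
          linarith)
      simpa only [Pi.neg_apply, lt_neg] using this
  refine ⟨max b₁ b₂, fun x => abs_le.2 ⟨?_, (h₁ x).trans (le_max_left _ _)⟩⟩
  have h := (h₂ x).trans (le_max_right b₁ b₂)
  simp only [Pi.neg_apply] at h
  linarith

end SphereGame
end

/-! ### The law of the game and the verification argument -/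

noncomputable section

namespace SphereGame

variable {N : ℕ} {δ ε K : ℝ} {Ω : Set (E N)}

section Sequences

variable {q a : ℕ → ℝ} {b c : ℝ}

/-- Telescoping gives `c * ∑ q ≤ a 0 - a n`. As `a` is bounded, `q` is summable; hence `q` and with
it `a` tend to zero, and the remainder disappears. No sign of `a` is needed. -/
theorem mul_sum_le_of_forall_le_sub (hc : 0 < c) (hq : ∀ k, 0 ≤ q k) (hq1 : ∀ k, q k ≤ 1)
    (ha : ∀ k, |a k| ≤ b * q k) (h : ∀ k, a (k + 1) ≤ a k - c * q k) (n : ℕ) :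
    c * ∑ k ∈ Finset.range n, q k ≤ a 0 := by
  have h1 : ∀ n, c * ∑ k ∈ Finset.range n, q k ≤ a 0 - a n := by
    intro n
    induction n with
    | zero => simp
    | succ n ih =>
      rw [Finset.sum_range_succ, mul_add]
      linarith [h n]
  have hb : ∀ k, b * q k ≤ |b| := fun k =>
    (mul_le_mul_of_nonneg_right (le_abs_self b) (hq k)).trans
      (mul_le_of_le_one_right (abs_nonneg b) (hq1 k))
  have hs : Summable q := by
    refine summable_of_sum_range_le (c := (a 0 + |b|) / c) hq fun n => ?_
    rw [le_div_iff₀' hc]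
    have := neg_le_of_abs_le (ha n)
    linarith [h1 n, hb n]
  have h2 : Filter.Tendsto (fun m => a 0 + b * q m) Filter.atTop (nhds (a 0)) := by
    simpa using (hs.tendsto_atTop_zero.const_mul b).const_add (a 0)
  refine ge_of_tendsto h2 (Filter.eventually_atTop.2 ⟨n, fun m hm => ?_⟩)
  have h3 : ∑ k ∈ Finset.range n, q k ≤ ∑ k ∈ Finset.range m, q k :=
    Finset.sum_le_sum_of_subset_of_nonneg (Finset.range_mono hm) fun k _ _ => hq k
  have := neg_le_of_abs_le (ha m)
  linarith [h1 m, mul_le_mul_of_nonneg_left h3 hc.le]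

theorem le_mul_tsum_of_forall_sub_le (hs : Summable q)
    (ha : ∀ k, |a k| ≤ b * q k) (h : ∀ k, a k - c * q k ≤ a (k + 1)) :
    a 0 ≤ c * ∑' k, q k := by
  have h1 : ∀ n, a 0 ≤ c * ∑ k ∈ Finset.range n, q k + b * q n := by
    intro n
    have h2 : a 0 ≤ c * ∑ k ∈ Finset.range n, q k + a n := by
      induction n with
      | zero => simp
      | succ n ih =>
        rw [Finset.sum_range_succ, mul_add]
        linarith [h n]
    linarith [le_of_abs_le (ha n)]
  have h2 : Filter.Tendsto (fun n => c * ∑ k ∈ Finset.range n, q k + b * q n) Filter.atTop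
      (nhds (c * ∑' k, q k)) := by
    simpa using (hs.hasSum.tendsto_sum_nat.const_mul c).add (hs.tendsto_atTop_zero.const_mul b)
  exact ge_of_tendsto' h2 h1

end Sequences

/-- The trajectories that are still in `Ω` at time `k`. -/
def alive (Ω : Set (E N)) (k : ℕ) : Set (ℕ → E N) := {ω | ∀ i ≤ k, ω i ∈ Ω}

/-- The histories that have not left `Ω`. -/
def aliveHistory (Ω : Set (E N)) (k : ℕ) : Set (Finset.Iic k → E N) := {h | ∀ i, h i ∈ Ω}

theorem preimage_aliveHistory (Ω : Set (E N)) (k : ℕ) :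
    Preorder.frestrictLe (π := fun _ => E N) k ⁻¹' aliveHistory Ω k = alive Ω k := by
  ext ω
  simp [aliveHistory, alive]

theorem measurableSet_aliveHistory (hΩ : MeasurableSet Ω) (k : ℕ) :
    MeasurableSet (aliveHistory Ω k) := by
  have : aliveHistory Ω k = ⋂ i, (fun h => h i) ⁻¹' Ω := by
    ext h
    simp [aliveHistory]
  rw [this]
  exact MeasurableSet.iInter fun i => measurable_pi_apply i hΩ

theorem measurableSet_alive (hΩ : MeasurableSet Ω) (k : ℕ) : MeasurableSet (alive Ω k) := by
  rw [← preimage_aliveHistory]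
  exact Preorder.measurable_frestrictLe k (measurableSet_aliveHistory hΩ k)

theorem numPlays_eq_tsum (Ω : Set (E N)) (ω : ℕ → E N) :
    numPlays Ω ω = ∑' k, (alive Ω k).indicator 1 ω := by
  classical
  by_cases h : ∃ n, ω n ∉ Ω
  · have h1 : ∀ k, (alive Ω k).indicator (1 : (ℕ → E N) → ℝ≥0∞) ω =
        if k ∈ Finset.range (Nat.find h) then 1 else 0 := by
      intro k
      have : ω ∈ alive Ω k ↔ k ∈ Finset.range (Nat.find h) := by
        rw [Finset.mem_range, Nat.lt_find_iff]
        simp [alive]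
      by_cases hk : k ∈ Finset.range (Nat.find h)
      · rw [if_pos hk, Set.indicator_of_mem (this.2 hk), Pi.one_apply]
      · rw [if_neg hk, Set.indicator_of_notMem (mt this.1 hk)]
    simp_rw [h1]
    rw [tsum_eq_sum (s := Finset.range (Nat.find h)) fun k hk => if_neg hk,
      Finset.sum_congr rfl fun k hk => if_pos hk]
    simp only [Finset.sum_const, Finset.card_range, nsmul_eq_mul, mul_one]
    refine le_antisymm
      (iInf₂_le (f := fun (n : ℕ) (_ : ω n ∉ Ω) => (n : ℝ≥0∞)) (Nat.find h) (Nat.find_spec h))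
      (le_iInf₂ fun n hn => ?_)
    exact_mod_cast Nat.find_min' h hn
  · push Not at h
    have h1 : ∀ k, (alive Ω k).indicator (1 : (ℕ → E N) → ℝ≥0∞) ω = 1 := by
      intro k
      have hk : ω ∈ alive Ω k := fun i _ => h i
      simp [hk]
    simp_rw [h1]
    simp [numPlays, h]

section Law

variable (hδ : 0 < δ) (P C : Strategy N δ) (x : E N)

instance : IsProbabilityMeasure (gameLaw hδ ε P C x) := by
  unfold gameLaw
  infer_instance

/-- The number of plays counts the times at which the game is still running, so its expectation is
the sum of the survival probabilities. -/
theorem payoff_eq_tsum (hΩ : MeasurableSet Ω) :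
    payoff hδ ε K Ω P C x =
      ENNReal.ofReal (ε ^ 2 * K) * ∑' k, gameLaw hδ ε P C x (alive Ω k) := by
  rw [payoff, lintegral_const_mul' _ _ ENNReal.ofReal_ne_top]
  simp_rw [numPlays_eq_tsum]
  rw [lintegral_tsum fun k => (measurable_one.indicator (measurableSet_alive hΩ k)).aemeasurable]
  simp_rw [lintegral_indicator_one (measurableSet_alive hΩ _)]

theorem map_gameLaw (k : ℕ) :
    (gameLaw hδ ε P C x).map (fun ω =>
      (Preorder.frestrictLe (π := fun _ => E N) k ω, ω (k + 1))) =
      ((gameLaw hδ ε P C x).map (Preorder.frestrictLe (π := fun _ => E N) k)) ⊗ₘ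
        stepKernel ε P C k := by
  have : ∀ n, IsMarkovKernel (stepKernel ε P C n) := isMarkovKernel_stepKernel hδ ε P C
  have h := Kernel.partialTraj_compProd_eq_map_traj (X := fun _ => E N)
    (κ := stepKernel ε P C) k.zero_le (x₀ := fun _ => x)
  rw [← Kernel.traj_map_frestrictLe_apply] at h
  exact h.symm

theorem integral_gameLaw_zero {w : E N → ℝ} (hw : Measurable w) :
    ∫ ω, w (ω 0) ∂(gameLaw hδ ε P C x) = w x := by
  have : ∀ n, IsMarkovKernel (stepKernel ε P C n) := isMarkovKernel_stepKernel hδ ε P C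
  have h := Kernel.traj_map_frestrictLe_apply (X := fun _ => E N)
    (κ := stepKernel ε P C) 0 0 (fun _ => x)
  rw [Kernel.partialTraj_self, Kernel.id_apply] at h
  have hm : Measurable fun g : Finset.Iic 0 → E N => w (g ⟨0, Finset.mem_Iic.2 le_rfl⟩) :=
    hw.comp (measurable_pi_apply _)
  have h2 := integral_map (μ := gameLaw hδ ε P C x)
    (φ := Preorder.frestrictLe (π := fun _ => E N) 0)
    (Preorder.measurable_frestrictLe 0).aemeasurable hm.aestronglyMeasurable
  change _ = ∫ ω, w (ω 0) ∂(gameLaw hδ ε P C x) at h2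
  rw [← h2]
  change ∫ g, _ ∂(Measure.map _
    (Kernel.traj (X := fun _ => E N) (stepKernel ε P C) 0 fun _ => x)) = _
  rw [h, integral_dirac' _ _ hm.stronglyMeasurable]

theorem integral_stepLaw {w : E N → ℝ} (hw : Measurable w) (k : ℕ) (h : Finset.Iic k → E N) :
    ∫ y, w y ∂(stepLaw ε P C k h) = ⨍ v in P.choice k h ∩ C.choice k h,
      w (h ⟨k, Finset.mem_Iic.2 le_rfl⟩ + ε • (v : E N)) ∂(σ N) := by
  rw [stepLaw, integral_map (by fun_prop) hw.aestronglyMeasurable, setAverage_eq,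
    ProbabilityTheory.cond, integral_smul_measure, ENNReal.toReal_inv]
  rfl

/-- The Markov property. -/
theorem setIntegral_alive_succ (hΩ : MeasurableSet Ω) {w : E N → ℝ} (hw : Measurable w) {b : ℝ}
    (hb : ∀ x, |w x| ≤ b) (hw0 : ∀ x ∉ Ω, w x = 0) (k : ℕ) :
    ∫ ω in alive Ω (k + 1), w (ω (k + 1)) ∂(gameLaw hδ ε P C x) =
      ∫ ω in alive Ω k, (∫ y, w y ∂(stepLaw ε P C k (Preorder.frestrictLe (π := fun _ => E N) k ω)))
        ∂(gameLaw hδ ε P C x) := by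
  have : IsMarkovKernel (stepKernel ε P C k) := isMarkovKernel_stepKernel hδ ε P C k
  set μ := gameLaw hδ ε P C x with hμ
  have hf : Measurable (Preorder.frestrictLe (π := fun _ => E N) k) :=
    Preorder.measurable_frestrictLe k
  have hpair : Measurable fun ω : ℕ → E N =>
      (Preorder.frestrictLe (π := fun _ => E N) k ω, ω (k + 1)) :=
    hf.prodMk (measurable_pi_apply _)
  have hH := measurableSet_aliveHistory hΩ k
  have hμf : IsProbabilityMeasure (μ.map (Preorder.frestrictLe (π := fun _ => E N) k)) :=
    Measure.isProbabilityMeasure_map hf.aemeasurable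
  -- As `w` vanishes off `Ω`, survival of the last step need not be imposed, and the remaining event
  -- depends only on the history up to `k`.
  have h1 : ∫ ω in alive Ω (k + 1), w (ω (k + 1)) ∂μ = ∫ ω in alive Ω k, w (ω (k + 1)) ∂μ := by
    rw [← integral_indicator (measurableSet_alive hΩ _), ← integral_indicator
      (measurableSet_alive hΩ _)]
    congr 1
    ext ω
    by_cases hk : ω ∈ alive Ω k
    · by_cases hk' : ω (k + 1) ∈ Ω
      · have : ω ∈ alive Ω (k + 1) := fun i hi => by
          rcases Nat.le_succ_iff.1 hi with h | h
          · exact hk i h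
          · exact h ▸ hk'
        simp [hk, this]
      · simp [Set.indicator, hw0 _ hk']
    · have : ω ∉ alive Ω (k + 1) := fun h => hk fun i hi => h i (hi.trans k.le_succ)
      simp [hk, this]
  have hint : IntegrableOn (fun p : (Finset.Iic k → E N) × E N => w p.2)
      (aliveHistory Ω k ×ˢ Set.univ)
      (μ.map (Preorder.frestrictLe (π := fun _ => E N) k) ⊗ₘ stepKernel ε P C k) := by
    refine Integrable.integrableOn (Integrable.of_bound
      (hw.comp measurable_snd).aestronglyMeasurable b
      (Filter.Eventually.of_forall fun p => hb _))
  have hw2 : Measurable fun p : (Finset.Iic k → E N) × E N => w p.2 := hw.comp measurable_snd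
  have h2 := Measure.setIntegral_compProd hH MeasurableSet.univ hint
  have h3 : StronglyMeasurable fun h => ∫ y, w y ∂(stepKernel ε P C k h) :=
    hw2.stronglyMeasurable.integral_kernel_prod_right'
  simp only [Measure.restrict_univ] at h2
  have hset : (fun ω : ℕ → E N => (Preorder.frestrictLe (π := fun _ => E N) k ω, ω (k + 1))) ⁻¹'
      (aliveHistory Ω k ×ˢ Set.univ) = alive Ω k := by
    rw [← preimage_aliveHistory]
    ext ω
    simp
  rw [hμ, ← map_gameLaw, setIntegral_map (hH.prod MeasurableSet.univ)
    hw2.aestronglyMeasurable hpair.aemeasurable, hset,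
    setIntegral_map hH h3.aestronglyMeasurable hf.aemeasurable, preimage_aliveHistory] at h2
  rw [h1]
  exact h2

theorem abs_setIntegral_alive_le {w : E N → ℝ} {b : ℝ}
    (hb : ∀ x, |w x| ≤ b) (k : ℕ) :
    |∫ ω in alive Ω k, w (ω k) ∂(gameLaw hδ ε P C x)| ≤ b * (gameLaw hδ ε P C x).real (alive Ω k) :=
  norm_setIntegral_le_of_norm_le_const (f := fun ω : ℕ → E N => w (ω k)) (measure_lt_top _ _)
    fun ω _ => hb (ω k)

theorem setIntegral_alive_zero {w : E N → ℝ} (hw : Measurable w)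
    (hw0 : ∀ x ∉ Ω, w x = 0) : ∫ ω in alive Ω 0, w (ω 0) ∂(gameLaw hδ ε P C x) = w x := by
  rw [← integral_gameLaw_zero hδ P C x hw, setIntegral_eq_integral_of_forall_compl_eq_zero]
  intro ω hω
  refine hw0 _ fun h => hω fun i hi => ?_
  rw [Nat.le_zero.1 hi]
  exact h

theorem integrable_comp_eval {w : E N → ℝ} (hw : Measurable w) {b : ℝ} (hb : ∀ x, |w x| ≤ b)
    (k : ℕ) : Integrable (fun ω => w (ω k)) (gameLaw hδ ε P C x) :=
  Integrable.of_bound (hw.comp (measurable_pi_apply k)).aestronglyMeasurable b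
    (Filter.Eventually.of_forall fun _ => hb _)

theorem integrable_integral_stepLaw {w : E N → ℝ} (hw : Measurable w) {b : ℝ}
    (hb : ∀ x, |w x| ≤ b) (k : ℕ) :
    Integrable (fun ω => ∫ y, w y ∂(stepLaw ε P C k (Preorder.frestrictLe (π := fun _ => E N) k ω)))
      (gameLaw hδ ε P C x) := by
  have hM : IsMarkovKernel (stepKernel ε P C k) := isMarkovKernel_stepKernel hδ ε P C k
  have hw2 : Measurable fun p : (Finset.Iic k → E N) × E N => w p.2 := hw.comp measurable_snd
  have h3 : StronglyMeasurable fun h => ∫ y, w y ∂(stepKernel ε P C k h) :=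
    hw2.stronglyMeasurable.integral_kernel_prod_right'
  refine Integrable.of_bound
    (h3.comp_measurable (Preorder.measurable_frestrictLe k)).aestronglyMeasurable b
    (Filter.Eventually.of_forall fun ω => ?_)
  have : IsProbabilityMeasure
    (stepLaw ε P C k (Preorder.frestrictLe (π := fun _ => E N) k ω)) := hM.isProbabilityMeasure _
  have h := norm_integral_le_of_norm_le_const
    (μ := stepLaw ε P C k (Preorder.frestrictLe (π := fun _ => E N) k ω))
    (f := w) (C := b) (Filter.Eventually.of_forall hb)
  rwa [probReal_univ, mul_one] at h

theorem setIntegral_alive_sub_const {w : E N → ℝ} (hw : Measurable w)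
    {b : ℝ} (hb : ∀ x, |w x| ≤ b) (c : ℝ) (k : ℕ) :
    ∫ ω in alive Ω k, (w (ω k) - c) ∂(gameLaw hδ ε P C x) =
      ∫ ω in alive Ω k, w (ω k) ∂(gameLaw hδ ε P C x) -
        c * (gameLaw hδ ε P C x).real (alive Ω k) := by
  rw [integral_sub (integrable_comp_eval hδ P C x hw hb k).integrableOn (integrable_const c)]
  simp [mul_comm]

/-- The supermartingale estimate: `mul_sum_le_of_forall_le_sub` is applied to the expectation of
`w(x_k)` on survival and to the survival probability. -/
theorem mul_sum_alive_le (hΩ : MeasurableSet Ω) {c : ℝ} (hc : 0 < c) {w : E N → ℝ}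
    (hw : Measurable w) {b : ℝ} (hb : ∀ x, |w x| ≤ b) (hw0 : ∀ x ∉ Ω, w x = 0)
    (H : ∀ k (h : Finset.Iic k → E N), h ⟨k, Finset.mem_Iic.2 le_rfl⟩ ∈ Ω →
      ∫ y, w y ∂(stepLaw ε P C k h) ≤ w (h ⟨k, Finset.mem_Iic.2 le_rfl⟩) - c) (n : ℕ) :
    c * ∑ k ∈ Finset.range n, (gameLaw hδ ε P C x).real (alive Ω k) ≤ w x := by
  rw [← setIntegral_alive_zero hδ P C x hw hw0 (ε := ε)]
  refine mul_sum_le_of_forall_le_sub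
    (a := fun k => ∫ ω in alive Ω k, w (ω k) ∂(gameLaw hδ ε P C x)) (b := b) hc
    (fun k => measureReal_nonneg) (fun k => measureReal_le_one)
    (abs_setIntegral_alive_le hδ P C x hb) (fun k => ?_) n
  rw [← setIntegral_alive_sub_const hδ P C x hw hb, setIntegral_alive_succ hδ P C x hΩ hw hb hw0]
  refine setIntegral_mono_on (integrable_integral_stepLaw hδ P C x hw hb k).integrableOn
    ((integrable_comp_eval hδ P C x hw hb k).sub (integrable_const c)).integrableOn
    (measurableSet_alive hΩ k) fun ω hω => H k _ (hω k le_rfl)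

theorem payoff_le (hΩ : MeasurableSet Ω) (hc : 0 < ε ^ 2 * K) {w : E N → ℝ}
    (hw : Measurable w) {b : ℝ} (hb : ∀ x, |w x| ≤ b) (hw0 : ∀ x ∉ Ω, w x = 0)
    (H : ∀ k (h : Finset.Iic k → E N), h ⟨k, Finset.mem_Iic.2 le_rfl⟩ ∈ Ω →
      ∫ y, w y ∂(stepLaw ε P C k h) ≤ w (h ⟨k, Finset.mem_Iic.2 le_rfl⟩) - ε ^ 2 * K) :
    payoff hδ ε K Ω P C x ≤ ENNReal.ofReal (w x) := by
  rw [payoff_eq_tsum hδ P C x hΩ, ← ENNReal.tsum_mul_left]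
  refine ENNReal.tsum_le_of_sum_range_le fun n => ?_
  refine le_trans (le_of_eq ?_)
    (ENNReal.ofReal_le_ofReal (mul_sum_alive_le hδ P C x hΩ hc hw hb hw0 H n))
  rw [ENNReal.ofReal_mul hc.le, ENNReal.ofReal_sum_of_nonneg fun k _ => measureReal_nonneg,
    Finset.mul_sum]
  exact Finset.sum_congr rfl fun k _ => by rw [ofReal_measureReal]

theorem le_payoff (hΩ : MeasurableSet Ω) (hc : 0 < ε ^ 2 * K) {w : E N → ℝ}
    (hw : Measurable w) {b : ℝ} (hb : ∀ x, |w x| ≤ b) (hw0 : ∀ x ∉ Ω, w x = 0)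
    (H : ∀ k (h : Finset.Iic k → E N), h ⟨k, Finset.mem_Iic.2 le_rfl⟩ ∈ Ω →
      w (h ⟨k, Finset.mem_Iic.2 le_rfl⟩) - ε ^ 2 * K ≤ ∫ y, w y ∂(stepLaw ε P C k h)) :
    ENNReal.ofReal (w x) ≤ payoff hδ ε K Ω P C x := by
  rw [payoff_eq_tsum hδ P C x hΩ]
  -- Carol may make the expected duration infinite, where the bound is trivial; otherwise
  -- summability removes the boundary term.
  by_cases htop : ∑' k, gameLaw hδ ε P C x (alive Ω k) = ⊤
  · rw [htop, ENNReal.mul_top (by simpa using hc)]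
    exact le_top
  have hs : Summable fun k => (gameLaw hδ ε P C x).real (alive Ω k) :=
    ENNReal.summable_toReal htop
  have key : w x ≤ ε ^ 2 * K * ∑' k, (gameLaw hδ ε P C x).real (alive Ω k) := by
    rw [← setIntegral_alive_zero hδ P C x hw hw0 (ε := ε)]
    refine le_mul_tsum_of_forall_sub_le
      (a := fun k => ∫ ω in alive Ω k, w (ω k) ∂(gameLaw hδ ε P C x)) (b := b) hs
      (abs_setIntegral_alive_le hδ P C x hb) (fun k => ?_)
    rw [← setIntegral_alive_sub_const hδ P C x hw hb,
      setIntegral_alive_succ hδ P C x hΩ hw hb hw0]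
    refine setIntegral_mono_on ((integrable_comp_eval hδ P C x hw hb k).sub
      (integrable_const _)).integrableOn (integrable_integral_stepLaw hδ P C x hw hb k).integrableOn
      (measurableSet_alive hΩ k) fun ω hω => H k (Preorder.frestrictLe (π := fun _ => E N) k ω)
        (hω k le_rfl)
  refine (ENNReal.ofReal_le_ofReal key).trans ?_
  rw [ENNReal.ofReal_mul hc.le, ENNReal.ofReal_tsum_of_nonneg (fun k => measureReal_nonneg) hs]
  refine le_of_eq (congrArg _ (tsum_congr fun k => ?_))
  rw [ofReal_measureReal]

end Law

theorem measurable_uncurry_step {w : E N → ℝ} (hw : Measurable w) (ε : ℝ) (n : ℕ) :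
    Measurable (Function.uncurry fun (h : Finset.Iic n → E N) (v : S N) =>
      w (h ⟨n, Finset.mem_Iic.2 le_rfl⟩ + ε • (v : E N))) := by
  have h : Measurable fun p : (Finset.Iic n → E N) × S N =>
      p.1 ⟨n, Finset.mem_Iic.2 le_rfl⟩ + ε • (p.2 : E N) := by fun_prop
  exact hw.comp h

/-- Paul's strategy that is optimal in every round when positions are worth `w`. -/
def topStrategy (hN : 2 ≤ N) (hδ : 0 < δ) (hδ' : δ < (1 / 2) * (σ N).real Set.univ) (ε : ℝ)
    {w : E N → ℝ} (hw : Measurable w) : Strategy N δ where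
  choice n h := topSet δ fun v : S N => w (h ⟨n, Finset.mem_Iic.2 le_rfl⟩ + ε • (v : E N))
  choice_mem n h := topSet_mem_admissible hN hδ hδ' (measurable_comp_step hw ε _)
  measurable_choice n := by
    have h := measurableSet_prod_topSet (δ := δ) (measurable_uncurry_step hw ε n)
    exact h

/-- Carol's strategy that is optimal in every round when positions are worth `w`. -/
def botStrategy (hN : 2 ≤ N) (hδ : 0 < δ) (hδ' : δ < (1 / 2) * (σ N).real Set.univ) (ε : ℝ)
    {w : E N → ℝ} (hw : Measurable w) : Strategy N δ where
  choice n h := botSet δ fun v : S N => w (h ⟨n, Finset.mem_Iic.2 le_rfl⟩ + ε • (v : E N))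
  choice_mem n h := botSet_mem_admissible hN hδ hδ' (measurable_comp_step hw ε _)
  measurable_choice n := by
    have h := measurableSet_prod_botSet (δ := δ) (measurable_uncurry_step hw ε n)
    exact h

theorem lowerValue_le_upperValue (hδ : 0 < δ) (x : E N) :
    lowerValue hδ ε K Ω x ≤ upperValue hδ ε K Ω x :=
  iSup_iInf_le_iInf_iSup _

/-- Verification: a solution of the dynamic programming principle is the value of the game. -/
theorem IsDPPSolution.value_eq (hN : 2 ≤ N) (hε : 0 < ε) (hδ : 0 < δ)
    (hδ' : δ < (1 / 2) * (σ N).real Set.univ) (hK : 0 < K) (hΩ : MeasurableSet Ω)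
    (hbdd : Bornology.IsBounded Ω) {w : E N → ℝ} (hw : IsDPPSolution ε δ K Ω w) (x : E N) :
    0 ≤ w x ∧ lowerValue hδ ε K Ω x = ENNReal.ofReal (w x) ∧
      upperValue hδ ε K Ω x = ENNReal.ofReal (w x) := by
  obtain ⟨b, hb⟩ := hw.exists_abs_le hN hε hδ hδ' hK hbdd
  have hc : 0 < ε ^ 2 * K := by positivity
  have hm := hw.measurable
  let P₀ := topStrategy hN hδ hδ' ε hm
  let C₀ := botStrategy hN hδ hδ' ε hm
  have hC : ∀ (P : Strategy N δ) k (h : Finset.Iic k → E N),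
      h ⟨k, Finset.mem_Iic.2 le_rfl⟩ ∈ Ω →
      ∫ y, w y ∂(stepLaw ε P C₀ k h) ≤ w (h ⟨k, Finset.mem_Iic.2 le_rfl⟩) - ε ^ 2 * K := by
    intro P k h hk
    rw [integral_stepLaw P C₀ hm, hw.eq_mid hN hδ hδ' hk, add_sub_cancel_right]
    exact average_le_mid hN hδ hδ' (measurable_comp_step hm ε _) (hw.integrable _ hk)
      (P.choice_mem k h)
  have hP : ∀ (C : Strategy N δ) k (h : Finset.Iic k → E N),
      h ⟨k, Finset.mem_Iic.2 le_rfl⟩ ∈ Ω →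
      w (h ⟨k, Finset.mem_Iic.2 le_rfl⟩) - ε ^ 2 * K ≤ ∫ y, w y ∂(stepLaw ε P₀ C k h) := by
    intro C k h hk
    rw [integral_stepLaw P₀ C hm, hw.eq_mid hN hδ hδ' hk, add_sub_cancel_right]
    exact mid_le_average hN hδ hδ' (measurable_comp_step hm ε _) (hw.integrable _ hk)
      (C.choice_mem k h)
  have h1 : upperValue hδ ε K Ω x ≤ ENNReal.ofReal (w x) :=
    iInf_le_of_le C₀ (iSup_le fun P => payoff_le hδ P C₀ x hΩ hc hm hb hw.eq_zero (hC P))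
  have h2 : ENNReal.ofReal (w x) ≤ lowerValue hδ ε K Ω x :=
    le_iSup_of_le P₀ (le_iInf fun C => le_payoff hδ P₀ C x hΩ hc hm hb hw.eq_zero (hP C))
  have h3 := lowerValue_le_upperValue (ε := ε) (K := K) (Ω := Ω) hδ x
  refine ⟨?_, le_antisymm (h3.trans h1) h2, le_antisymm h1 (h2.trans h3)⟩
  -- The empty sum already gives `0 ≤ w x`.
  simpa using mul_sum_alive_le hδ P₀ C₀ x hΩ hc hm hb hw.eq_zero (hC P₀) 0

end SphereGame
end

/-! ### Existence of a solution by monotone iteration -/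

noncomputable section

namespace SphereGame

variable {N : ℕ} {δ ε K : ℝ} {Ω : Set (E N)}

/-- The operator whose fixed points are the solutions of the dynamic programming principle. -/
def dppStep (ε δ K : ℝ) (Ω : Set (E N)) (u : E N → ℝ) : E N → ℝ :=
  Ω.indicator fun x => mid δ (fun v : S N => u (x + ε • (v : E N))) + ε ^ 2 * K

/-- The iterates of `dppStep` on the zero function. -/
def dppIter (ε δ K : ℝ) (Ω : Set (E N)) (n : ℕ) : E N → ℝ := (dppStep ε δ K Ω)^[n] 0

theorem dppIter_succ (ε δ K : ℝ) (Ω : Set (E N)) (n : ℕ) :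
    dppIter ε δ K Ω (n + 1) = dppStep ε δ K Ω (dppIter ε δ K Ω n) :=
  Function.iterate_succ_apply' _ _ _

theorem measurable_dppIter (hΩ : MeasurableSet Ω) (n : ℕ) : Measurable (dppIter ε δ K Ω n) := by
  induction n with
  | zero => exact measurable_zero
  | succ n ih =>
    rw [dppIter_succ]
    have h : Measurable fun p : E N × S N => p.1 + ε • (p.2 : E N) := by fun_prop
    have hu : Measurable (Function.uncurry fun (x : E N) (v : S N) =>
      dppIter ε δ K Ω n (x + ε • (v : E N))) := ih.comp h
    have hm := measurable_mid (δ := δ) hu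
    exact (hm.add_const _).indicator hΩ

theorem dppIter_of_notMem {x : E N} (hx : x ∉ Ω) (n : ℕ) : dppIter ε δ K Ω n x = 0 := by
  cases n with
  | zero => rfl
  | succ n => rw [dppIter_succ, dppStep, Set.indicator_of_notMem hx]

theorem integrable_comp_step {u : E N → ℝ} (hu : Measurable u) {b : ℝ} (hb : ∀ x, |u x| ≤ b)
    (ε : ℝ) (x : E N) : Integrable (fun v : S N => u (x + ε • (v : E N))) (σ N) :=
  Integrable.of_bound (measurable_comp_step hu ε x).aestronglyMeasurable b
    (Filter.Eventually.of_forall fun _ => hb _)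

/-- The paraboloid `K ((R + ε)² - |x|²)` is a supersolution. -/
theorem mid_le_of_le_paraboloid (hN : 2 ≤ N) (hδ : 0 < δ)
    (hδ' : δ < (1 / 2) * (σ N).real Set.univ) {u : E N → ℝ} (hu : Measurable u) {x : E N}
    (hui : Integrable (fun v : S N => u (x + ε • (v : E N))) (σ N)) {a : ℝ}
    (h : ∀ v : S N, u (x + ε • (v : E N)) ≤ a - K * ‖x + ε • (v : E N)‖ ^ 2) :
    mid δ (fun v : S N => u (x + ε • (v : E N))) + ε ^ 2 * K ≤ a - K * ‖x‖ ^ 2 := by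
  -- On unit vectors the paraboloid is a constant plus this odd function, and the constant is
  -- smaller by exactly `ε²K` than the value at `x`.
  let g : S N → ℝ := fun v => -(2 * K * ε) * inner ℝ x (v : E N)
  have hgc : Continuous g := by fun_prop
  have hgi : Integrable g (σ N) := hgc.integrable_of_hasCompactSupport (.of_compactSpace g)
  have h1 : ∀ v : S N, a - K * ‖x + ε • (v : E N)‖ ^ 2 =
      (a - K * ‖x‖ ^ 2 - ε ^ 2 * K) + g v := by
    intro v
    have hv : ‖(v : E N)‖ = 1 := by simp
    simp only [g]
    rw [norm_add_sq_real, inner_smul_right, norm_smul, hv, mul_one, Real.norm_eq_abs, sq_abs]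
    ring
  have h2 := mid_mono hN hδ hδ' (measurable_comp_step hu ε x) hui
    (hgc.measurable.const_add (a - K * ‖x‖ ^ 2 - ε ^ 2 * K)) ((integrable_const _).add hgi)
    fun v => (h v).trans_eq (h1 v)
  have h3 := mid_const_add_odd_le hN hδ hδ' hgc.measurable hgi (fun v => by simp [g])
    (a - K * ‖x‖ ^ 2 - ε ^ 2 * K)
  linarith

/-- The claims go through one induction, since monotonicity of `mid` needs the integrability that
the bounds supply. The radius `R + ε` keeps the paraboloid nonnegative one step outside `Ω`, where
the iterates are zero. -/
theorem dppIter_le_succ_and_le (hN : 2 ≤ N) (hε : 0 < ε) (hδ : 0 < δ)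
    (hδ' : δ < (1 / 2) * (σ N).real Set.univ) (hK : 0 < K) (hΩ : MeasurableSet Ω) {R : ℝ}
    (hR : ∀ x ∈ Ω, ‖x‖ ≤ R) (n : ℕ) :
    (∀ x, 0 ≤ dppIter ε δ K Ω n x) ∧ (∀ x, dppIter ε δ K Ω n x ≤ dppIter ε δ K Ω (n + 1) x) ∧
      ∀ x ∈ Ω, dppIter ε δ K Ω n x ≤ K * (R + ε) ^ 2 - K * ‖x‖ ^ 2 := by
  have hbound : ∀ n, (∀ x, 0 ≤ dppIter ε δ K Ω n x) →
      (∀ x ∈ Ω, dppIter ε δ K Ω n x ≤ K * (R + ε) ^ 2 - K * ‖x‖ ^ 2) →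
      ∀ x, |dppIter ε δ K Ω n x| ≤ K * (R + ε) ^ 2 := by
    intro n h0 h1 x
    rw [abs_of_nonneg (h0 x)]
    by_cases hx : x ∈ Ω
    · have : 0 ≤ K * ‖x‖ ^ 2 := by positivity
      linarith [h1 x hx]
    · rw [dppIter_of_notMem hx]
      positivity
  have hsuper : ∀ n, (∀ x, 0 ≤ dppIter ε δ K Ω n x) →
      (∀ x ∈ Ω, dppIter ε δ K Ω n x ≤ K * (R + ε) ^ 2 - K * ‖x‖ ^ 2) →
      ∀ x ∈ Ω, dppIter ε δ K Ω (n + 1) x ≤ K * (R + ε) ^ 2 - K * ‖x‖ ^ 2 := by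
    intro n h0 h1 x hx
    rw [dppIter_succ, dppStep, Set.indicator_of_mem hx]
    refine mid_le_of_le_paraboloid hN hδ hδ' (measurable_dppIter hΩ n)
      (integrable_comp_step (measurable_dppIter hΩ n) (hbound n h0 h1) ε x) fun v => ?_
    by_cases hy : x + ε • (v : E N) ∈ Ω
    · exact h1 _ hy
    · rw [dppIter_of_notMem hy, ← mul_sub]
      have hv : ‖(v : E N)‖ = 1 := by simp
      have h2 : ‖x + ε • (v : E N)‖ ≤ R + ε := by
        refine (norm_add_le _ _).trans ?_
        rw [norm_smul, hv, mul_one, Real.norm_of_nonneg hε.le]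
        linarith [hR x hx]
      have h3 := pow_le_pow_left₀ (norm_nonneg _) h2 2
      exact mul_nonneg hK.le (sub_nonneg.2 h3)
  induction n with
  | zero =>
    refine ⟨fun x => le_rfl, fun x => ?_, fun x hx => ?_⟩
    · rw [dppIter_succ, dppStep]
      refine Set.indicator_nonneg (fun x _ => ?_) x
      have : mid δ (fun v : S N => dppIter ε δ K Ω 0 (x + ε • (v : E N))) = 0 := by
        simp [mid, dppIter]
      rw [this]
      positivity
    · have h2 : ‖x‖ ≤ R + ε := (hR x hx).trans (by linarith)
      have h3 := pow_le_pow_left₀ (norm_nonneg _) h2 2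
      rw [← mul_sub]
      exact mul_nonneg hK.le (sub_nonneg.2 h3)
  | succ n ih =>
    obtain ⟨h0, h1, h2⟩ := ih
    have h0' : ∀ x, 0 ≤ dppIter ε δ K Ω (n + 1) x := fun x => (h0 x).trans (h1 x)
    have h2' := hsuper n h0 h2
    refine ⟨h0', fun x => ?_, h2'⟩
    rw [dppIter_succ, dppIter_succ _ _ _ _ (n + 1), dppStep, dppStep]
    refine Set.indicator_le_indicator ?_
    have := mid_mono hN hδ hδ' (measurable_comp_step (measurable_dppIter hΩ n) ε x)
      (integrable_comp_step (measurable_dppIter hΩ n) (hbound n h0 h2) ε x)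
      (measurable_comp_step (measurable_dppIter (ε := ε) (δ := δ) (K := K) hΩ (n + 1)) ε x)
      (integrable_comp_step (measurable_dppIter hΩ (n + 1)) (hbound (n + 1) h0' h2') ε x)
      fun v => h1 _
    linarith

/-- The dynamic programming principle has a solution. -/
theorem exists_isDPPSolution (hN : 2 ≤ N) (hε : 0 < ε) (hδ : 0 < δ)
    (hδ' : δ < (1 / 2) * (σ N).real Set.univ) (hK : 0 < K) (hΩ : MeasurableSet Ω)
    (hbdd : Bornology.IsBounded Ω) : ∃ u : E N → ℝ, IsDPPSolution ε δ K Ω u := by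
  obtain ⟨R, hR⟩ := hbdd.exists_norm_le
  have hiter := dppIter_le_succ_and_le hN hε hδ hδ' hK hΩ hR
  set b := K * (R + ε) ^ 2 with hb
  have hle : ∀ n x, dppIter ε δ K Ω n x ≤ b := by
    intro n x
    by_cases hx : x ∈ Ω
    · have : 0 ≤ K * ‖x‖ ^ 2 := by positivity
      linarith [(hiter n).2.2 x hx]
    · rw [dppIter_of_notMem hx]
      positivity
  have hbound : ∀ n x, |dppIter ε δ K Ω n x| ≤ b := fun n x => by
    rw [abs_of_nonneg ((hiter n).1 x)]
    exact hle n x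
  set u : E N → ℝ := fun x => ⨆ n, dppIter ε δ K Ω n x with hu
  have hlim : ∀ x, Filter.Tendsto (fun n => dppIter ε δ K Ω n x) Filter.atTop (nhds (u x)) :=
    fun x => tendsto_atTop_ciSup (monotone_nat_of_le_succ fun n => (hiter n).2.1 x)
      ⟨b, by rintro _ ⟨n, rfl⟩; exact hle n x⟩
  have hum : Measurable u :=
    measurable_of_tendsto_metrizable (measurable_dppIter hΩ) (tendsto_pi_nhds.2 hlim)
  have hub : ∀ x, |u x| ≤ b := fun x =>
    le_of_tendsto' (hlim x).abs fun n => hbound n x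
  refine ⟨u, hum, fun x _ => integrable_comp_step hum hub ε x, fun x hx => ?_, fun x hx => ?_⟩
  · rw [iSup_iInf_average hN hδ hδ' (measurable_comp_step hum ε x)
      (integrable_comp_step hum hub ε x)]
    -- Pointwise convergence and the common bound give `L¹` convergence on each sphere, which is
    -- what `mid_le_mid_add` needs.
    have hL1 : Filter.Tendsto (fun n => ∫ v : S N, |dppIter ε δ K Ω n (x + ε • (v : E N)) -
        u (x + ε • (v : E N))| ∂(σ N)) Filter.atTop (nhds 0) := by
      have h := tendsto_integral_of_dominated_convergence (μ := σ N)
        (F := fun n (v : S N) => |dppIter ε δ K Ω n (x + ε • (v : E N)) - u (x + ε • (v : E N))|)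
        (f := fun _ => 0) (fun _ => b + b)
        (fun n => ((measurable_comp_step (measurable_dppIter hΩ n) ε x).sub
          (measurable_comp_step hum ε x)).abs.aestronglyMeasurable)
        (integrable_const _)
        (fun n => Filter.Eventually.of_forall fun v => by
          rw [Real.norm_eq_abs, abs_abs]
          exact (abs_sub _ _).trans (add_le_add (hbound n _) (hub _)))
        (Filter.Eventually.of_forall fun v => by
          simpa using ((hlim (x + ε • (v : E N))).sub_const (u (x + ε • (v : E N)))).abs)
      simpa using h
    have hmid : Filter.Tendsto
        (fun n => mid δ fun v : S N => dppIter ε δ K Ω n (x + ε • (v : E N)))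
        Filter.atTop (nhds (mid δ fun v : S N => u (x + ε • (v : E N)))) := by
      rw [tendsto_iff_dist_tendsto_zero]
      have h0 := hL1.const_mul (2 * δ)⁻¹
      rw [mul_zero] at h0
      refine squeeze_zero (fun n => dist_nonneg) (fun n => ?_) h0
      have h1 := mid_le_mid_add hN hδ hδ' (measurable_comp_step (measurable_dppIter hΩ n) ε x)
        (integrable_comp_step (measurable_dppIter hΩ n) (hbound n) ε x)
        (measurable_comp_step hum ε x) (integrable_comp_step hum hub ε x)
      have h2 := mid_le_mid_add hN hδ hδ' (measurable_comp_step hum ε x)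
        (integrable_comp_step hum hub ε x)
        (measurable_comp_step (measurable_dppIter hΩ n) ε x)
        (integrable_comp_step (measurable_dppIter hΩ n) (hbound n) ε x)
      simp only [abs_sub_comm (u _)] at h2
      rw [Real.dist_eq, abs_le]
      constructor <;> linarith
    have h1 := (hlim x).comp (Filter.tendsto_add_atTop_nat 1)
    refine tendsto_nhds_unique h1 ((hmid.add_const (ε ^ 2 * K)).congr fun n => ?_)
    simp only [Function.comp]
    rw [dppIter_succ, dppStep, Set.indicator_of_mem hx]
  · simp [hu, dppIter_of_notMem hx]

end SphereGame
end

theorem theorem1p2 {N : ℕ} (hN : 2 ≤ N) {ε δ K : ℝ} (hε : 0 < ε) (hδ : 0 < δ)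
    (hδ' : δ < (1 / 2) * (SphereGame.σ N).real Set.univ) (hK : 0 < K)
    {Ω : Set (SphereGame.E N)} (hne : Ω.Nonempty) (hopen : IsOpen Ω)
    (hbdd : Bornology.IsBounded Ω) (hconv : Convex ℝ Ω) (hstrict : StrictConvex ℝ (closure Ω)) :
    (∀ x, SphereGame.upperValue hδ ε K Ω x = SphereGame.lowerValue hδ ε K Ω x ∧
      SphereGame.lowerValue hδ ε K Ω x ≠ ⊤) ∧
    SphereGame.IsDPPSolution ε δ K Ω (fun x => (SphereGame.lowerValue hδ ε K Ω x).toReal) ∧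
    ∀ w : SphereGame.E N → ℝ, SphereGame.IsDPPSolution ε δ K Ω w →
      w = fun x => (SphereGame.lowerValue hδ ε K Ω x).toReal := by
  have hΩ := hopen.measurableSet
  have key : ∀ w : SphereGame.E N → ℝ, SphereGame.IsDPPSolution ε δ K Ω w →
      w = fun x => (SphereGame.lowerValue hδ ε K Ω x).toReal := by
    intro w hw
    ext x
    obtain ⟨h0, h1, -⟩ := hw.value_eq hN hε hδ hδ' hK hΩ hbdd x
    rw [h1, ENNReal.toReal_ofReal h0]
  obtain ⟨u, hu⟩ := SphereGame.exists_isDPPSolution hN hε hδ hδ' hK hΩ hbdd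
  refine ⟨fun x => ?_, key u hu ▸ hu, key⟩
  obtain ⟨-, h1, h2⟩ := hu.value_eq hN hε hδ hδ' hK hΩ hbdd x
  rw [h1, h2]
  exact ⟨rfl, ENNReal.ofReal_ne_top⟩
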